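/- For $\delta\in(0,1)$ let, in polar coordinates, $$\Omega^\delta=\{(r\cos\theta,r\sin\theta)\mid \delta<r<1,\ 0<\theta<\pi\},$$ $$\Omega^\delta_+=\{(r\cos\theta,r\sin\theta)\mid \delta<r<1,\ \pi/4<\theta<\pi\},\qquad \Omega^\delta_-=\{(r\cos\theta,r\sin\theta)\mid \delta<r<1,\ 0<\theta<\pi/4\}.$$ Let $\sigma_+>0$ and $\sigma_-<0$ be constants, and let $\sigma^\delta$ be the function on $\Omega^\delta$ equal to $\sigma_\pm$ in $\Omega^\delta_\pm$. Let $H^1_0(\Omega^\delta)$ be the Sobolev space of complex-valued functions (the closure of $C_c^\infty(\Omega^\delta)$ in $H^1(\Omega^\delta)$), with the norm $\|v\|_{H^1_0(\Omega^\delta)}=\|\nabla v\|_{L^2(\Omega^\delta)}$, and let $H^{-1}(\Omega^\delta)$ be the space of continuous antilinear forms on $H^1_0(\Omega^\delta)$, with the norm $\|f\|_{H^{-1}(\Omega^\delta)}=\sup_{v\ne0}|\langle f,v\rangle|/\|v\|_{H^1_0(\Omega^\delta)}$. Let $A^\delta:H^1_0(\Omega^\delta)\to H^{-1}(\Omega^\delta)$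 be the continuous linear operator defined by $$\langle A^\delta u,v\rangle=\int_{\Omega^\delta}\sigma^\delta\,\nabla u\cdot\overline{\nabla v}\,dx,\qquad u,v\in H^1_0(\Omega^\delta).$$ Assume that $\kappa_\sigma:=\sigma_- /\sigma_+\in(-\infty,-1)\cup(-1/3,0)$. Then, for all $\delta\in(0,1)$, $A^\delta$ is an isomorphism (a linear bijection, continuous with continuous inverse). Moreover, there exists a constant $c>0$, independent of $\delta$, such that $$\|u\|_{H^1_0(\Omega^\delta)}\le c\,\|A^\delta u\|_{H^{-1}(\Omega^\delta)}\qquad\text{for all }\delta\in(0,1)\text{ and all }u\in H^1_0(\Omega^\delta).$$ -/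

import Mathlib

open MeasureTheory Set
open scoped ContDiff

noncomputable section

namespace HalfAnnulus

/-- The Euclidean plane. -/
abbrev Plane : Type := EuclideanSpace ℝ (Fin 2)

/-! ### Sobolev spaces -/

/-- `L²(Ω)`, complex valued. -/
abbrev L2 (Ω : Set Plane) : Type := Lp ℂ 2 (volume.restrict Ω)

/-- `L²(Ω)²`, complex vector fields. -/
abbrev L2Vec (Ω : Set Plane) : Type := Lp (EuclideanSpace ℂ (Fin 2)) 2 (volume.restrict Ω)

/-- The classical gradient `(∂₁φ, ∂₂φ)` of a complex valued function on the plane. -/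
def grad (φ : Plane → ℂ) (x : Plane) : EuclideanSpace ℂ (Fin 2) :=
  WithLp.toLp 2 fun i => fderiv ℝ φ x (EuclideanSpace.single i 1)

/-- `φ ∈ C_c^∞(Ω)`. -/
structure IsTestFunction (Ω : Set Plane) (φ : Plane → ℂ) : Prop where
  smooth : ContDiff ℝ ∞ φ
  compact : HasCompactSupport φ
  support : tsupport φ ⊆ Ω

theorem IsTestFunction.add {Ω : Set Plane} {φ ψ : Plane → ℂ} (hφ : IsTestFunction Ω φ)
    (hψ : IsTestFunction Ω ψ) : IsTestFunction Ω (φ + ψ) :=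
  ⟨hφ.smooth.add hψ.smooth, hφ.compact.add hψ.compact,
    (tsupport_add φ ψ).trans (union_subset hφ.support hψ.support)⟩

theorem IsTestFunction.zero (Ω : Set Plane) : IsTestFunction Ω 0 :=
  ⟨contDiff_const, HasCompactSupport.zero, by simp [tsupport]⟩

theorem IsTestFunction.smul {Ω : Set Plane} {φ : Plane → ℂ} (c : ℂ)
    (hφ : IsTestFunction Ω φ) : IsTestFunction Ω (c • φ) :=
  ⟨contDiff_const.smul hφ.smooth, hφ.compact.smul_left,
    (closure_mono (Function.support_const_smul_subset c φ)).trans hφ.support⟩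

theorem grad_add {Ω : Set Plane} {φ ψ : Plane → ℂ} (hφ : IsTestFunction Ω φ)
    (hψ : IsTestFunction Ω ψ) (x : Plane) : grad (φ + ψ) x = grad φ x + grad ψ x := by
  have h1 := hφ.smooth.differentiable (by simp) x
  have h2 := hψ.smooth.differentiable (by simp) x
  ext i
  simp [grad, fderiv_add h1 h2]

theorem grad_smul {Ω : Set Plane} {φ : Plane → ℂ} (c : ℂ) (hφ : IsTestFunction Ω φ)
    (x : Plane) : grad (c • φ) x = c • grad φ x := by
  have h1 := hφ.smooth.differentiable (by simp) x
  ext i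
  simp [grad, fderiv_const_smul h1 c]

/-- The pairs `(φ, ∇φ)`, `φ ∈ C_c^∞(Ω)`, in `L²(Ω) × L²(Ω)²`. -/
def testPairs (Ω : Set Plane) : Submodule ℂ (L2 Ω × L2Vec Ω) where
  carrier := {p | ∃ φ : Plane → ℂ, IsTestFunction Ω φ ∧
    p.1 =ᵐ[volume.restrict Ω] φ ∧ p.2 =ᵐ[volume.restrict Ω] grad φ}
  zero_mem' := by
    refine ⟨0, IsTestFunction.zero Ω, Lp.coeFn_zero _ _ _, ?_⟩
    have h : grad 0 = 0 := by
      funext x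
      ext i
      simp [grad]
    rw [h]
    exact Lp.coeFn_zero _ _ _
  add_mem' := by
    rintro p q ⟨φ, hφ, h1, h2⟩ ⟨ψ, hψ, h3, h4⟩
    refine ⟨φ + ψ, hφ.add hψ, (Lp.coeFn_add _ _).trans (h1.add h3), ?_⟩
    filter_upwards [Lp.coeFn_add p.2 q.2, h2, h4] with x hx h2 h4
    rw [grad_add hφ hψ, ← h2, ← h4]
    exact hx
  smul_mem' := by
    rintro c p ⟨φ, hφ, h1, h2⟩
    refine ⟨c • φ, hφ.smul c, (Lp.coeFn_smul _ _).trans (h1.const_smul c), ?_⟩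
    filter_upwards [Lp.coeFn_smul c p.2, h2] with x hx h2
    rw [grad_smul c hφ, ← h2]
    exact hx

/-- `H¹₀(Ω)`: the closure of `C_c^∞(Ω)` for the `H¹` norm, a function `v` being recorded together
with its weak gradient as the pair `(v, ∇v) ∈ L²(Ω) × L²(Ω)²`. This is a type of its own because
it carries the norm `‖∇v‖` and not the norm of the product. -/
def H10 (Ω : Set Plane) : Type := (testPairs Ω).topologicalClosure

instance (Ω : Set Plane) : AddCommGroup (H10 Ω) :=
  inferInstanceAs (AddCommGroup (testPairs Ω).topologicalClosure)

instance (Ω : Set Plane) : Module ℂ (H10 Ω) :=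
  inferInstanceAs (Module ℂ (testPairs Ω).topologicalClosure)

/-- The `L²` function underlying an element of `H¹₀(Ω)`. -/
def H10.toL2 {Ω : Set Plane} : H10 Ω →ₗ[ℂ] L2 Ω :=
  LinearMap.fst ℂ (L2 Ω) (L2Vec Ω) ∘ₗ (testPairs Ω).topologicalClosure.subtype

/-- The weak gradient of an element of `H¹₀(Ω)`. -/
def H10.gradient {Ω : Set Plane} : H10 Ω →ₗ[ℂ] L2Vec Ω :=
  LinearMap.snd ℂ (L2 Ω) (L2Vec Ω) ∘ₗ (testPairs Ω).topologicalClosure.subtype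

/-- `‖v‖_{H¹₀(Ω)} = ‖∇v‖_{L²(Ω)}`. (For bounded `Ω` this is definite, by Poincaré's inequality,
but that is not needed for the definitions below.) -/
instance (Ω : Set Plane) : SeminormedAddCommGroup (H10 Ω) :=
  SeminormedAddCommGroup.induced (H10 Ω) (L2Vec Ω) H10.gradient

instance (Ω : Set Plane) : NormedSpace ℂ (H10 Ω) :=
  NormedSpace.induced ℂ (H10 Ω) (L2Vec Ω) H10.gradient

theorem H10.norm_def {Ω : Set Plane} (u : H10 Ω) : ‖u‖ = ‖u.gradient‖ := rfl

/-- `H⁻¹(Ω)`: the continuous antilinear forms on `H¹₀(Ω)`, with the dual norm. -/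
abbrev Hneg1 (Ω : Set Plane) : Type := H10 Ω →L⋆[ℂ] ℂ

/-! ### The geometry and the coefficient -/

/-- `{(r cos θ, r sin θ) | δ < r < 1, α < θ < β}`. -/
def sector (δ α β : ℝ) : Set Plane :=
  (fun p : ℝ × ℝ => !₂[p.1 * Real.cos p.2, p.1 * Real.sin p.2]) '' (Ioo δ 1 ×ˢ Ioo α β)

/-- `Ω^δ` -/
def Omega (δ : ℝ) : Set Plane := sector δ 0 Real.pi

/-- `Ω₊^δ` -/
def OmegaPlus (δ : ℝ) : Set Plane := sector δ (Real.pi / 4) Real.pi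

/-- `Ω₋^δ` -/
def OmegaMinus (δ : ℝ) : Set Plane := sector δ 0 (Real.pi / 4)

open Classical in
/-- `σ^δ = σ₊` in `Ω₊^δ` and `σ^δ = σ₋` in `Ω₋^δ`. (The value `0` elsewhere is immaterial, the
interface being a null set.) -/
def sigma (σp σm δ : ℝ) (x : Plane) : ℝ :=
  if x ∈ OmegaPlus δ then σp else if x ∈ OmegaMinus δ then σm else 0

theorem measurableSet_sector (δ α β : ℝ) : MeasurableSet (sector δ α β) := by
  have ho : IsOpen (Ioo δ 1 ×ˢ Ioo α β) := isOpen_Ioo.prod isOpen_Ioo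
  have hs : IsSigmaCompact (Ioo δ 1 ×ˢ Ioo α β) := by
    have : LocallyCompactSpace (Ioo δ 1 ×ˢ Ioo α β : Set (ℝ × ℝ)) := ho.locallyCompactSpace
    exact isSigmaCompact_iff_sigmaCompactSpace.mpr inferInstance
  have hc : Continuous (fun p : ℝ × ℝ =>
      (!₂[p.1 * Real.cos p.2, p.1 * Real.sin p.2] : Plane)) := by
    refine (PiLp.continuous_toLp 2 _).comp (continuous_pi fun i => ?_)
    fin_cases i <;> simp <;> fun_prop
  obtain ⟨K, hK, hU⟩ := hs.image hc
  rw [sector, ← hU]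
  exact MeasurableSet.iUnion fun n => (hK n).measurableSet

theorem measurable_sigma (σp σm δ : ℝ) : Measurable (sigma σp σm δ) :=
  Measurable.ite (measurableSet_sector _ _ _) measurable_const
    (Measurable.ite (measurableSet_sector _ _ _) measurable_const measurable_const)

theorem abs_sigma_le (σp σm δ : ℝ) (x : Plane) : |sigma σp σm δ x| ≤ |σp| + |σm| := by
  unfold sigma
  split_ifs <;> simp [add_nonneg]

/-! ### The operator -/

/-- `(σ^δ ∇u, ∇v)_{Ω^δ} = ∫_{Ω^δ} σ^δ ∇u · conj ∇v`. (The inner product of `ℂ²` is antilinear in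
its first argument.) -/
def form (σp σm δ : ℝ) (u v : H10 (Omega δ)) : ℂ :=
  ∫ x in Omega δ, (sigma σp σm δ x : ℂ) * inner ℂ (v.gradient x) (u.gradient x)

theorem integrable_form (σp σm δ : ℝ) (u v : H10 (Omega δ)) :
    Integrable (fun x => (sigma σp σm δ x : ℂ) * inner ℂ (v.gradient x) (u.gradient x))
      (volume.restrict (Omega δ)) := by
  refine (L2.integrable_inner (𝕜 := ℂ) v.gradient u.gradient).bdd_mul (c := |σp| + |σm|)
    ((Complex.measurable_ofReal.comp (measurable_sigma σp σm δ)).aestronglyMeasurable) ?_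
  filter_upwards with x
  simpa using abs_sigma_le σp σm δ x

theorem norm_form_le (σp σm δ : ℝ) (u v : H10 (Omega δ)) :
    ‖form σp σm δ u v‖ ≤ (|σp| + |σm|) * ‖u‖ * ‖v‖ := by
  have hb : ∀ x, ‖(sigma σp σm δ x : ℂ) • u.gradient x‖ ≤ (|σp| + |σm|) * ‖u.gradient x‖ := by
    intro x
    rw [norm_smul, Complex.norm_real, Real.norm_eq_abs]
    exact mul_le_mul_of_nonneg_right (abs_sigma_le σp σm δ x) (norm_nonneg _)
  have hm : MemLp (fun x => (sigma σp σm δ x : ℂ) • u.gradient x) 2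
      (volume.restrict (Omega δ)) :=
    (Lp.memLp u.gradient).of_le_mul
      ((Complex.measurable_ofReal.comp (measurable_sigma σp σm δ)).aestronglyMeasurable.smul
        (Lp.aestronglyMeasurable u.gradient)) (Filter.Eventually.of_forall hb)
  have he : form σp σm δ u v = inner ℂ v.gradient (hm.toLp _) := by
    rw [form, L2.inner_def]
    refine integral_congr_ae ?_
    filter_upwards [hm.coeFn_toLp] with x hx
    rw [hx, inner_smul_right]
  have hn : ‖hm.toLp _‖ ≤ (|σp| + |σm|) * ‖u.gradient‖ := by
    refine Lp.norm_le_mul_norm_of_ae_le_mul ?_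
    filter_upwards [hm.coeFn_toLp] with x hx
    rw [hx]
    exact hb x
  rw [he, H10.norm_def, H10.norm_def, mul_comm _ ‖v.gradient‖]
  exact (norm_inner_le_norm _ _).trans (mul_le_mul_of_nonneg_left hn (norm_nonneg _))

/-- The operator `A^δ : H¹₀(Ω^δ) → H⁻¹(Ω^δ)`, `⟨A^δ u, v⟩ = (σ^δ ∇u, ∇v)_{Ω^δ}`. -/
def A (σp σm δ : ℝ) : H10 (Omega δ) →L[ℂ] Hneg1 (Omega δ) :=
  LinearMap.mkContinuous₂
    (LinearMap.mk₂'ₛₗ (RingHom.id ℂ) (starRingEnd ℂ) (form σp σm δ)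
      (by
        intro u u' v
        rw [form, form, form, ← integral_add (integrable_form ..) (integrable_form ..)]
        refine integral_congr_ae ?_
        rw [map_add]
        filter_upwards [Lp.coeFn_add u.gradient u'.gradient] with x hx
        rw [hx, Pi.add_apply, inner_add_right, mul_add])
      (by
        intro c u v
        rw [form, form, RingHom.id_apply, smul_eq_mul, ← integral_const_mul]
        refine integral_congr_ae ?_
        rw [map_smul]
        filter_upwards [Lp.coeFn_smul c u.gradient] with x hx
        rw [hx, Pi.smul_apply, inner_smul_right]
        ring)
      (by
        intro u v v'
        rw [form, form, form, ← integral_add (integrable_form ..) (integrable_form ..)]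
        refine integral_congr_ae ?_
        rw [map_add]
        filter_upwards [Lp.coeFn_add v.gradient v'.gradient] with x hx
        rw [hx, Pi.add_apply, inner_add_left, mul_add])
      (by
        intro c u v
        rw [form, form, smul_eq_mul, ← integral_const_mul]
        refine integral_congr_ae ?_
        rw [map_smul]
        filter_upwards [Lp.coeFn_smul c v.gradient] with x hx
        rw [hx, Pi.smul_apply, inner_smul_left]
        ring))
    (|σp| + |σm|) (norm_form_le σp σm δ)

theorem A_apply (σp σm δ : ℝ) (u v : H10 (Omega δ)) :
    A σp σm δ u v =
      ∫ x in Omega δ, (sigma σp σm δ x : ℂ) * inner ℂ (v.gradient x) (u.gradient x) := rfl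

end HalfAnnulus

end

/-! The form changes sign, so it is not coercive; it is tested instead against a folded function
(T-coercivity). Write `a` for the dominant value of |σ| and `b` for the other, and let `C` contain
the region of weight `b`. Given `u`, put `v = u` off `C` and `v = 2ψ - u` on `C`, where `ψ = u ∘ G`
and `G` sends that region to the other side, fixes the interface θ = π/4 and preserves the radius.
Subtracting `u` on `C` flips the sign of σ there, and up to a global sign Re⟨Au, v⟩ is `a
∫_{Cᶜ}|∇u|² + b ∫_C|∇u|² - 2b Re ∫_C ∇u·∇ψ̄`. Since `∫_C|∇ψ|² ≤ N ∫_{Cᶜ}|∇u|²`, Young's inequality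
absorbs the cross term as soon as `N b < a` (`exists_bound_of_fold`).

If κ < -1, `G` is the reflection across the diagonal, an isometry, with `N = 1`. If κ > -1/3, `G` is
θ ↦ π - 3θ, which carries (0, π/4) onto (π/4, π) and has `N = 3`. As `G` preserves the radius,
neither `N` nor the resulting constant depends on δ.

The estimate is proved for test functions and extended by density. Their folds are only Lipschitz,
and belong to H¹₀ by mollification (`exists_H10_of_lipschitz`). As σ is real the form is hermitian,
so the lower bound alone gives surjectivity too (`surjective_of_hermitian_of_bounded_below`). -/

namespace HalfAnnulus

/-! ### Hermitian forms that are bounded below -/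

open InnerProductSpace in
/-- A bounded hermitian sesquilinear form on a Hilbert space which is bounded below represents every
continuous antilinear form. -/
theorem surjective_of_hermitian_of_bounded_below {V : Type*} [NormedAddCommGroup V]
    [InnerProductSpace ℂ V] [CompleteSpace V] (a : V →L[ℂ] V →L⋆[ℂ] ℂ)
    (hsymm : ∀ u v, a u v = starRingEnd ℂ (a v u)) {c : ℝ} (hc : 0 < c)
    (hbound : ∀ u, ‖u‖ ≤ c * ‖a u‖) : Function.Surjective a := by
  set M : V →L[ℂ] V := continuousLinearMapOfBilin a.flip
  have hM : ∀ u v, inner ℂ (M u) v = a v u := fun u v => by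
    simp [M, continuousLinearMapOfBilin_apply]
  have hle : ∀ u, ‖a u‖ ≤ ‖M u‖ := fun u => by
    refine ContinuousLinearMap.opNorm_le_bound _ (norm_nonneg _) fun v => ?_
    rw [hsymm, RCLike.norm_conj, ← hM]
    exact norm_inner_le_norm _ _
  have hb : ∀ u, ‖u‖ ≤ c * ‖M u‖ := fun u =>
    (hbound u).trans (mul_le_mul_of_nonneg_left (hle u) hc.le)
  have hanti : AntilipschitzWith ⟨c, hc.le⟩ M := M.antilipschitz_of_bound hb
  have hclosed : IsClosed (M.range : Set V) := by
    have h : IsClosed (range M) := hanti.isClosed_range M.uniformContinuous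
    exact h
  have : CompleteSpace M.range := hclosed.completeSpace_coe
  -- The range is closed, so it suffices that its orthogonal complement vanishes. `M` is
  -- self-adjoint, hence `w ⊥ range M` gives `‖M w‖² = 0`, and the lower bound gives `w = 0`.
  have htop : M.range = ⊤ := by
    rw [← Submodule.orthogonal_eq_bot_iff, Submodule.eq_bot_iff]
    intro w hw
    have hMw : M w = 0 := by
      rw [← inner_self_eq_zero (𝕜 := ℂ), hM, hsymm, ← hM,
        (Submodule.mem_orthogonal _ _).1 hw (M (M w)) ⟨M w, rfl⟩, map_zero]
    have := hb w
    rw [hMw, norm_zero, mul_zero] at this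
    exact norm_le_zero_iff.1 this
  intro F
  obtain ⟨G, hG⟩ : ∃ G : V →L[ℂ] ℂ, ∀ v, G v = starRingEnd ℂ (F v) :=
    ⟨
      LinearMap.mkContinuous
        { toFun := fun v => starRingEnd ℂ (F v)
          map_add' := fun u v => by simp
          map_smul' := fun t v => by simp } ‖F‖
        (fun v => by simpa using F.le_opNorm v), fun v => rfl⟩
  obtain ⟨u, hu⟩ : (toDual ℂ V).symm G ∈ M.range := htop ▸ Submodule.mem_top
  refine ⟨u, ContinuousLinearMap.ext fun v => ?_⟩
  have hu' : M u = (toDual ℂ V).symm G := hu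
  rw [hsymm, ← hM, hu', toDual_symm_apply, hG, Complex.conj_conj]

/-- The same on a space isometric to a Hilbert space, as an isomorphism onto the antidual. -/
theorem exists_continuousLinearEquiv_of_hermitian {X V : Type*} [SeminormedAddCommGroup X]
    [NormedSpace ℂ X] [NormedAddCommGroup V] [InnerProductSpace ℂ V] [CompleteSpace V]
    (ι : X ≃ₗᵢ[ℂ] V) (a : X →L[ℂ] X →L⋆[ℂ] ℂ)
    (hsymm : ∀ u v, a u v = starRingEnd ℂ (a v u)) {c : ℝ} (hc : 0 < c)
    (hbound : ∀ u, ‖u‖ ≤ c * ‖a u‖) :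
    ∃ e : X ≃L[ℂ] (X →L⋆[ℂ] ℂ), ∀ u, e u = a u := by
  have hinj : Function.Injective a := by
    intro u v huv
    have h := hbound (u - v)
    rw [map_sub, huv, sub_self, norm_zero, mul_zero] at h
    -- `X` carries only a seminorm; its definiteness is read off from the image in `V`.
    have h' : ‖ι (u - v)‖ ≤ 0 := by rwa [ι.norm_map]
    exact sub_eq_zero.1 (ι.map_eq_zero_iff.1 (norm_le_zero_iff.1 h'))
  let b : V →L[ℂ] V →L⋆[ℂ] ℂ :=
    LinearMap.mkContinuous₂
      (LinearMap.mk₂'ₛₗ (RingHom.id ℂ) (starRingEnd ℂ) (fun u v => a (ι.symm u) (ι.symm v))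
        (by simp) (by simp) (by simp) (by simp)) ‖a‖
      (fun u v => by simpa using a.le_opNorm₂ (ι.symm u) (ι.symm v))
  have hb : ∀ u v, b u v = a (ι.symm u) (ι.symm v) := fun u v => rfl
  have hbsurj : Function.Surjective b := by
    refine surjective_of_hermitian_of_bounded_below b (fun u v => ?_) hc fun u => ?_
    · rw [hb, hb, hsymm]
    · rw [← ι.symm.norm_map]
      refine (hbound _).trans (mul_le_mul_of_nonneg_left ?_ hc.le)
      refine ContinuousLinearMap.opNorm_le_bound _ (norm_nonneg _) fun v => ?_
      simpa [hb] using (b u).le_opNorm (ι v)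
  have hsurj : Function.Surjective a := by
    intro F
    let F' : V →L⋆[ℂ] ℂ := F.comp (ι.symm.toContinuousLinearEquiv : V →L[ℂ] X)
    obtain ⟨u, hu⟩ := hbsurj F'
    refine ⟨ι.symm u, ContinuousLinearMap.ext fun v => ?_⟩
    have := hb u (ι v)
    rw [hu] at this
    simpa [F'] using this.symm
  let e := LinearEquiv.ofBijective (a : X →ₗ[ℂ] X →L⋆[ℂ] ℂ) ⟨hinj, hsurj⟩
  refine ⟨e.toContinuousLinearEquivOfBounds ‖a‖ c (fun u => a.le_opNorm u) (fun F => ?_),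
    fun u => rfl⟩
  have := hbound (e.symm F)
  rwa [show a (e.symm F) = F from e.apply_symm_apply F] at this

end HalfAnnulus

namespace HalfAnnulus

/-! ### Test functions in `H¹₀` -/

theorem Lp_norm_sq_eq_integral {α E : Type*} [MeasurableSpace α] {μ : Measure α}
    [NormedAddCommGroup E] [InnerProductSpace ℂ E] (f : Lp E 2 μ) :
    ‖f‖ ^ 2 = ∫ x, ‖f x‖ ^ 2 ∂μ := by
  have h : inner ℂ f f = ∫ x, inner ℂ (f x) (f x) ∂μ := L2.inner_def f f
  simp only [inner_self_eq_norm_sq_to_K] at h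
  norm_cast at h

/-- The linear map taking the differential to the gradient. -/
noncomputable def gradOf : (Plane →L[ℝ] ℂ) →L[ℝ] EuclideanSpace ℂ (Fin 2) :=
  LinearMap.toContinuousLinearMap
    { toFun := fun L => WithLp.toLp 2 fun i => L (EuclideanSpace.single i 1)
      map_add' := fun L M => by ext i; simp
      map_smul' := fun c L => by ext i; simp }

theorem grad_eq_gradOf (φ : Plane → ℂ) (x : Plane) : grad φ x = gradOf (fderiv ℝ φ x) := rfl

/-- Young's inequality for Poincaré, with `t` in the role of the first coordinate. The weight 1/2
lets the `‖φ‖²` term be absorbed. -/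
theorem neg_mul_fderiv_norm_sq_le (φ : Plane → ℂ) (x : Plane) {t : ℝ} (ht : |t| ≤ 1) :
    -(t * (2 • (innerSL ℝ (φ x)).comp (fderiv ℝ φ x)) (EuclideanSpace.single 0 1)) ≤
      2⁻¹ * ‖φ x‖ ^ 2 + 2 * ‖grad φ x‖ ^ 2 := by
  set e : Plane := EuclideanSpace.single 0 1 with he
  have h1 : ‖fderiv ℝ φ x e‖ ≤ ‖grad φ x‖ :=
    PiLp.norm_apply_le (p := 2) (grad φ x) 0
  have h2 : |inner ℝ (φ x) (fderiv ℝ φ x e)| ≤ ‖φ x‖ * ‖grad φ x‖ :=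
    (abs_real_inner_le_norm _ _).trans (mul_le_mul_of_nonneg_left h1 (norm_nonneg _))
  have h3 : |t * inner ℝ (φ x) (fderiv ℝ φ x e)| ≤ ‖φ x‖ * ‖grad φ x‖ := by
    rw [abs_mul]
    exact (mul_le_of_le_one_left (abs_nonneg _) ht).trans h2
  have h4 := (abs_le.1 h3).1
  have h5 : (2 • (innerSL ℝ (φ x)).comp (fderiv ℝ φ x)) e =
      2 * inner ℝ (φ x) (fderiv ℝ φ x e) := by
    simp only [smul_apply, ContinuousLinearMap.comp_apply,
      innerSL_apply_apply, nsmul_eq_mul, Nat.cast_ofNat]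
  rw [h5]
  nlinarith [sq_nonneg (‖φ x‖ - 2 * ‖grad φ x‖)]

namespace IsTestFunction

variable {Ω : Set Plane} {φ : Plane → ℂ}

theorem continuous_grad (hφ : IsTestFunction Ω φ) : Continuous (grad φ) :=
  gradOf.continuous.comp (hφ.smooth.continuous_fderiv (by simp))

theorem hasCompactSupport_grad (hφ : IsTestFunction Ω φ) : HasCompactSupport (grad φ) :=
  (hφ.compact.fderiv ℝ).comp_left (g := gradOf) (map_zero _)

theorem memLp (hφ : IsTestFunction Ω φ) : MemLp φ 2 (volume.restrict Ω) :=
  (hφ.smooth.continuous.memLp_of_hasCompactSupport hφ.compact).restrict Ω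

theorem memLp_grad (hφ : IsTestFunction Ω φ) : MemLp (grad φ) 2 (volume.restrict Ω) :=
  (hφ.continuous_grad.memLp_of_hasCompactSupport hφ.hasCompactSupport_grad).restrict Ω

theorem mem_testPairs (hφ : IsTestFunction Ω φ) :
    (hφ.memLp.toLp φ, hφ.memLp_grad.toLp (grad φ)) ∈ testPairs Ω :=
  ⟨φ, hφ, hφ.memLp.coeFn_toLp, hφ.memLp_grad.coeFn_toLp⟩

/-- A test function as an element of `H¹₀(Ω)`. -/
noncomputable def toH10 (hφ : IsTestFunction Ω φ) : H10 Ω :=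
  ⟨(hφ.memLp.toLp φ, hφ.memLp_grad.toLp (grad φ)),
    Submodule.le_topologicalClosure _ hφ.mem_testPairs⟩

theorem gradient_toH10 (hφ : IsTestFunction Ω φ) :
    hφ.toH10.gradient =ᵐ[volume.restrict Ω] grad φ := hφ.memLp_grad.coeFn_toLp

theorem support_subset (hφ : IsTestFunction Ω φ) : Function.support φ ⊆ Ω :=
  (subset_tsupport φ).trans hφ.support

theorem eq_zero_of_notMem (hφ : IsTestFunction Ω φ) {x : Plane} (hx : x ∉ Ω) : φ x = 0 := by
  by_contra h
  exact hx (hφ.support_subset h)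

theorem grad_eq_zero_of_notMem (hφ : IsTestFunction Ω φ) {x : Plane} (hx : x ∉ Ω) :
    grad φ x = 0 := by
  rw [grad_eq_gradOf, fderiv_of_notMem_tsupport ℝ (fun h => hx (hφ.support h)), map_zero]

theorem integrable_norm_grad_sq (hφ : IsTestFunction Ω φ) :
    Integrable (fun x => ‖grad φ x‖ ^ 2) :=
  (hφ.continuous_grad.memLp_of_hasCompactSupport (p := 2)
    hφ.hasCompactSupport_grad).integrable_norm_pow two_ne_zero

end IsTestFunction

theorem integrable_mul_fderiv_and_integral_eq {g : Plane → ℝ} (hgc : ContDiff ℝ ∞ g)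
    (hgs : HasCompactSupport g) (p : Plane →L[ℝ] ℝ) (e : Plane) (hp : p e = 1) :
    Integrable (fun x => p x * fderiv ℝ g x e) ∧
      ∫ x, p x * fderiv ℝ g x e = - ∫ x, g x := by
  have hcs : HasCompactSupport (fun x => fderiv ℝ g x e) :=
    (hgs.fderiv ℝ).comp_left (g := fun L : Plane →L[ℝ] ℝ => L e) rfl
  have hcc : Continuous (fun x => fderiv ℝ g x e) :=
    (hgc.continuous_fderiv (by simp)).clm_apply continuous_const
  have hint : Integrable (fun x => p x * fderiv ℝ g x e) :=
    (p.continuous.mul hcc).integrable_of_hasCompactSupport hcs.mul_left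
  have hint0 : Integrable g := hgc.continuous.integrable_of_hasCompactSupport hgs
  have hp' : ∀ x, fderiv ℝ p x e = 1 := fun x => by rw [ContinuousLinearMap.fderiv, hp]
  refine ⟨hint, ?_⟩
  rw [integral_mul_fderiv_eq_neg_fderiv_mul_of_integrable _ hint]
  · simp only [hp', one_mul]
  · exact (p.continuous.mul hgc.continuous).integrable_of_hasCompactSupport hgs.mul_left
  · exact fun x _ => p.differentiableAt
  · exact fun x _ => hgc.differentiable (by simp) x
  · simpa only [hp', one_mul] using hint0

namespace IsTestFunction

variable {Ω : Set Plane} {φ : Plane → ℂ}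

/-- Integrating by parts against the coordinate `x 0`, whose derivative is 1, gives ∫|φ|² = -∫ x₀
∂₀|φ|² ≤ ½∫|φ|² + 2∫|∇φ|². -/
theorem integral_norm_sq_le (hφ : IsTestFunction Ω φ) (hΩ : ∀ x ∈ Ω, |x 0| ≤ 1) :
    ∫ x in Ω, ‖φ x‖ ^ 2 ≤ 4 * ∫ x in Ω, ‖grad φ x‖ ^ 2 := by
  have hg : ∀ x, HasFDerivAt (fun x => ‖φ x‖ ^ 2)
      (2 • (innerSL ℝ (φ x)).comp (fderiv ℝ φ x)) x := fun x =>
    (hφ.smooth.differentiable (by simp) x).hasFDerivAt.norm_sq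
  have hgc : ContDiff ℝ ∞ (fun x => ‖φ x‖ ^ 2) := hφ.smooth.norm_sq ℝ
  have hgs : HasCompactSupport (fun x => ‖φ x‖ ^ 2) :=
    hφ.compact.comp_left (g := fun z : ℂ => ‖z‖ ^ 2) (by simp)
  have hint0 : Integrable (fun x => ‖φ x‖ ^ 2) :=
    hgc.continuous.integrable_of_hasCompactSupport hgs
  obtain ⟨hint, hparts⟩ := integrable_mul_fderiv_and_integral_eq hgc hgs
    (EuclideanSpace.proj 0) (EuclideanSpace.single 0 1) (by simp)
  have hpt : ∀ x : Plane, -((EuclideanSpace.proj 0 : Plane →L[ℝ] ℝ) x *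
      fderiv ℝ (fun x => ‖φ x‖ ^ 2) x (EuclideanSpace.single 0 1)) ≤
      2⁻¹ * ‖φ x‖ ^ 2 + 2 * ‖grad φ x‖ ^ 2 := fun x => by
    rw [(hg x).fderiv]
    by_cases hx : x ∈ Ω
    · exact neg_mul_fderiv_norm_sq_le φ x (hΩ x hx)
    · rw [hφ.eq_zero_of_notMem hx, map_zero, ContinuousLinearMap.zero_comp, smul_zero,
        zero_apply, mul_zero, neg_zero]
      positivity
  have hmain := integral_mono hint.neg
    ((hint0.const_mul 2⁻¹).add (hφ.integrable_norm_grad_sq.const_mul 2)) hpt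
  simp only [Pi.neg_apply, Pi.add_apply] at hmain
  rw [integral_neg, hparts, integral_add (hint0.const_mul _)
    (hφ.integrable_norm_grad_sq.const_mul _), integral_const_mul, integral_const_mul] at hmain
  rw [setIntegral_eq_integral_of_forall_compl_eq_zero
      (fun x hx => by simp [hφ.eq_zero_of_notMem hx]),
    setIntegral_eq_integral_of_forall_compl_eq_zero
      (fun x hx => by simp [hφ.grad_eq_zero_of_notMem hx])]
  linarith

end IsTestFunction

/-! ### Poincaré's inequality and completeness -/

/-- The gradient as a continuous map on the closure of the test pairs, with the `H¹` norm. -/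
noncomputable def gradientCLM (Ω : Set Plane) : (testPairs Ω).topologicalClosure →L[ℂ] L2Vec Ω :=
  (ContinuousLinearMap.snd ℂ (L2 Ω) (L2Vec Ω)).comp (testPairs Ω).topologicalClosure.subtypeL

theorem norm_toL2_le {Ω : Set Plane} (hΩ : ∀ x ∈ Ω, |x 0| ≤ 1) {p : L2 Ω × L2Vec Ω}
    (hp : p ∈ (testPairs Ω).topologicalClosure) : ‖p.1‖ ≤ 2 * ‖p.2‖ := by
  have hcl : IsClosed {p : L2 Ω × L2Vec Ω | ‖p.1‖ ≤ 2 * ‖p.2‖} :=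
    isClosed_le (by fun_prop) (by fun_prop)
  refine closure_minimal (t := {p : L2 Ω × L2Vec Ω | ‖p.1‖ ≤ 2 * ‖p.2‖}) ?_ hcl hp
  rintro p ⟨φ, hφ, h1, h2⟩
  have h := hφ.integral_norm_sq_le hΩ
  have e1 : ‖p.1‖ ^ 2 = ∫ x in Ω, ‖φ x‖ ^ 2 := by
    rw [Lp_norm_sq_eq_integral]
    exact integral_congr_ae (h1.mono fun x hx => by simp only [hx])
  have e2 : ‖p.2‖ ^ 2 = ∫ x in Ω, ‖grad φ x‖ ^ 2 := by
    rw [Lp_norm_sq_eq_integral]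
    exact integral_congr_ae (h2.mono fun x hx => by simp only [hx])
  rw [← e1, ← e2] at h
  refine (sq_le_sq₀ (norm_nonneg _) (by positivity)).1 ?_
  rw [mul_pow]
  norm_num1
  exact h

/-- Poincaré compares the full H¹ norm with the gradient norm. It makes the gradient injective with
closed range, so H¹₀ with the gradient norm is a Hilbert space. -/
theorem antilipschitz_gradientCLM {Ω : Set Plane} (hΩ : ∀ x ∈ Ω, |x 0| ≤ 1) :
    AntilipschitzWith 2 (gradientCLM Ω) := by
  refine (gradientCLM Ω).antilipschitz_of_bound fun p => ?_
  have h := norm_toL2_le hΩ p.2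
  have e : gradientCLM Ω p = p.1.2 := rfl
  rw [e]
  refine max_le h ?_
  change ‖p.1.2‖ ≤ 2 * ‖p.1.2‖
  linarith [norm_nonneg p.1.2]

/-- `H¹₀(Ω)` is isometric to a Hilbert space, the space of gradients. -/
noncomputable def H10.equivRange {Ω : Set Plane} (hΩ : ∀ x ∈ Ω, |x 0| ≤ 1) :
    H10 Ω ≃ₗᵢ[ℂ] LinearMap.range (H10.gradient (Ω := Ω)) where
  toLinearEquiv := LinearEquiv.ofInjective H10.gradient
    (show Function.Injective (gradientCLM Ω) from (antilipschitz_gradientCLM hΩ).injective)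
  norm_map' _ := rfl

theorem completeSpace_range_gradient {Ω : Set Plane} (hΩ : ∀ x ∈ Ω, |x 0| ≤ 1) :
    CompleteSpace (LinearMap.range (H10.gradient (Ω := Ω))) := by
  have h : IsClosed (range (gradientCLM Ω)) :=
    (antilipschitz_gradientCLM hΩ).isClosed_range (gradientCLM Ω).uniformContinuous
  have h' : IsClosed (LinearMap.range (H10.gradient (Ω := Ω)) : Set (L2Vec Ω)) := h
  exact h'.completeSpace_coe

/-- Test functions are dense in `H¹₀(Ω)`. -/
theorem dense_test (Ω : Set Plane) :
    Dense {u : H10 Ω | ∃ φ, ∃ hφ : IsTestFunction Ω φ, u = hφ.toH10} := by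
  intro u
  rw [Metric.mem_closure_iff]
  intro ε hε
  obtain ⟨q, hq, hqd⟩ := Metric.mem_closure_iff.1 u.2 ε hε
  obtain ⟨φ, hφ, h1, h2⟩ := hq
  refine ⟨hφ.toH10, ⟨φ, hφ, rfl⟩, ?_⟩
  have h : q.2 = (hφ.toH10).gradient := Lp.ext (h2.trans hφ.gradient_toH10.symm)
  rw [dist_eq_norm, H10.norm_def, map_sub, ← h, ← dist_eq_norm]
  -- The product carries the max norm, so closeness of pairs bounds the distance of gradients.
  exact lt_of_le_of_lt (le_max_right _ _) hqd

theorem form_conj (σp σm δ : ℝ) (u v : H10 (Omega δ)) :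
    A σp σm δ u v = starRingEnd ℂ (A σp σm δ v u) := by
  rw [A_apply, A_apply, ← integral_conj]
  refine integral_congr_ae (Filter.Eventually.of_forall fun x => ?_)
  simp

/-- A lower bound for `A` on test functions gives the same bound on `H¹₀`. -/
theorem bound_of_bound_test {σp σm δ c : ℝ}
    (h : ∀ φ, ∀ hφ : IsTestFunction (Omega δ) φ, ‖hφ.toH10‖ ≤ c * ‖A σp σm δ hφ.toH10‖)
    (u : H10 (Omega δ)) : ‖u‖ ≤ c * ‖A σp σm δ u‖ := by
  have hcl : IsClosed {u : H10 (Omega δ) | ‖u‖ ≤ c * ‖A σp σm δ u‖} :=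
    isClosed_le (by fun_prop) (by fun_prop)
  refine closure_minimal (t := {u : H10 (Omega δ) | ‖u‖ ≤ c * ‖A σp σm δ u‖}) ?_ hcl
    (dense_test _ u)
  rintro _ ⟨φ, hφ, rfl⟩
  exact h φ hφ

end HalfAnnulus

namespace HalfAnnulus

/-! ### Lipschitz functions with compact support belong to `H¹₀` -/

open Filter Topology ContinuousLinearMap
open scoped Convolution

/-- The derivative may fall on `f` although it exists only almost everywhere: the difference
quotients of the integrand are dominated by `K ‖ρ‖`. Hence the gradients of the mollified functions
are mollified gradients. -/
theorem hasFDerivAt_convolution_of_lipschitz {ρ : Plane → ℝ} (hρ : Continuous ρ)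
    (hρs : HasCompactSupport ρ) {f : Plane → ℂ} {K : NNReal} (hf : LipschitzWith K f)
    (hd : ∀ᵐ x, DifferentiableAt ℝ f x) (x : Plane) :
    HasFDerivAt (ρ ⋆[lsmul ℝ ℝ, volume] f) ((ρ ⋆[lsmul ℝ ℝ, volume] fderiv ℝ f) x) x := by
  have hint : ∀ y, Integrable (fun t => ρ t • f (y - t)) := fun y =>
    (hρ.smul (hf.continuous.comp (by fun_prop))).integrable_of_hasCompactSupport
      hρs.smul_right
  refine (hasFDerivAt_integral_of_dominated_loc_of_lip' (𝕜 := ℝ) (s := univ)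
    (F := fun y t => ρ t • f (y - t)) (F' := fun t => ρ t • fderiv ℝ f (x - t))
    (bound := fun t => K * ‖ρ t‖) univ_mem (fun y _ => (hint y).aestronglyMeasurable)
    (hint x) ?_ ?_ ?_ ?_).2
  · refine hρ.aestronglyMeasurable.smul ?_
    exact ((measurable_fderiv ℝ f).stronglyMeasurable.comp_measurable
      (measurable_const.sub measurable_id)).aestronglyMeasurable
  · refine Eventually.of_forall fun t y _ => ?_
    rw [← smul_sub, norm_smul]
    have := hf.dist_le_mul (y - t) (x - t)
    rw [dist_sub_right, dist_eq_norm, dist_eq_norm] at this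
    calc ‖ρ t‖ * ‖f (y - t) - f (x - t)‖ ≤ ‖ρ t‖ * (K * ‖y - x‖) := by gcongr
      _ = K * ‖ρ t‖ * ‖y - x‖ := by ring
  · exact (hρ.integrable_of_hasCompactSupport hρs).norm.const_mul _
  · have hq := (Measure.measurePreserving_sub_left (volume : Measure Plane)
      x).quasiMeasurePreserving.ae hd
    filter_upwards [hq] with t ht
    have h1 : HasFDerivAt (fun y => f (y - t)) (fderiv ℝ f (x - t)) x := by
      rw [hasFDerivAt_comp_sub]
      exact ht.hasFDerivAt
    exact h1.const_smul (ρ t)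

theorem norm_normed_convolution_le {E : Type*} [NormedAddCommGroup E] [NormedSpace ℝ E]
    (ρ : ContDiffBump (0 : Plane)) {g : Plane → E} {B : ℝ} (hB : ∀ x, ‖g x‖ ≤ B) (x : Plane) :
    ‖(ρ.normed volume ⋆[lsmul ℝ ℝ, volume] g) x‖ ≤ B := by
  have hi : Integrable (fun t => ρ.normed volume t * B) :=
    (ρ.integrable_normed (μ := volume)).mul_const B
  refine (norm_integral_le_of_norm_le hi (Eventually.of_forall fun t => ?_)).trans ?_
  · rw [lsmul_apply, norm_smul, Real.norm_of_nonneg (ρ.nonneg_normed t)]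
    exact mul_le_mul_of_nonneg_left (hB _) (ρ.nonneg_normed t)
  · rw [integral_mul_const, ρ.integral_normed, one_mul]

/-- Bounded convergence in `L²`. -/
theorem tendsto_toLp_of_bounded {α E : Type*} [MeasurableSpace α] {μ : Measure α}
    [IsFiniteMeasure μ] [NormedAddCommGroup E] [InnerProductSpace ℂ E] {F : ℕ → α → E} {G : α → E}
    (hF : ∀ n, MemLp (F n) 2 μ) (hG : MemLp G 2 μ) {B : ℝ} (hB : ∀ n x, ‖F n x‖ ≤ B)
    (hlim : ∀ᵐ x ∂μ, Tendsto (fun n => F n x) atTop (𝓝 (G x))) :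
    Tendsto (fun n => (hF n).toLp (F n)) atTop (𝓝 (hG.toLp G)) := by
  have hsq : Tendsto (fun n => ‖(hF n).toLp (F n) - hG.toLp G‖ ^ 2) atTop (𝓝 0) := by
    have hform : ∀ n, ‖(hF n).toLp (F n) - hG.toLp G‖ ^ 2 = ∫ x, ‖F n x - G x‖ ^ 2 ∂μ := by
      intro n
      rw [Lp_norm_sq_eq_integral, ← MemLp.toLp_sub]
      refine integral_congr_ae ?_
      filter_upwards [((hF n).sub hG).coeFn_toLp] with x hx
      rw [hx, Pi.sub_apply]
    simp only [hform]
    have h0 : (0 : ℝ) = ∫ _x : α, (0 : ℝ) ∂μ := by simp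
    rw [h0]
    refine tendsto_integral_of_dominated_convergence (fun _ => (B + B) ^ 2)
      (fun n => ((hF n).sub hG).aestronglyMeasurable.norm.pow 2) (integrable_const _)
      (fun n => ?_) ?_
    · filter_upwards [hlim] with x hx
      have hGx : ‖G x‖ ≤ B := le_of_tendsto hx.norm (Eventually.of_forall fun n => hB n x)
      rw [Real.norm_of_nonneg (by positivity)]
      gcongr
      exact (norm_sub_le _ _).trans (add_le_add (hB n x) hGx)
    · filter_upwards [hlim] with x hx
      have := ((hx.sub_const (G x)).norm).pow 2
      simpa using this
  rw [tendsto_iff_norm_sub_tendsto_zero]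
  have := (Real.continuous_sqrt.tendsto 0).comp hsq
  simpa [Function.comp_def, Real.sqrt_sq] using this

/-- A Lipschitz function with compact support in an open set of finite measure belongs to `H¹₀`, with
its almost everywhere defined classical gradient. -/
theorem exists_H10_of_lipschitz {Ω : Set Plane} (hΩ : IsOpen Ω) (hvol : volume Ω ≠ ⊤)
    {f : Plane → ℂ} {K : NNReal} (hf : LipschitzWith K f) (hfs : HasCompactSupport f)
    (hsub : tsupport f ⊆ Ω) (hd : ∀ᵐ x, DifferentiableAt ℝ f x) :
    ∃ v : H10 Ω, v.gradient =ᵐ[volume.restrict Ω] grad f := by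
  have : IsFiniteMeasure (volume.restrict Ω) := ⟨by simpa using hvol.lt_top⟩
  -- Mollifying at a radius at most `η` keeps the support inside `Ω`.
  obtain ⟨η, hη, hηs⟩ := hfs.isCompact.exists_cthickening_subset_open hΩ hsub
  let ρ : ℕ → ContDiffBump (0 : Plane) := fun n =>
    ⟨η / 2 / (n + 1), η / (n + 1), by positivity, by gcongr; linarith⟩
  have hrout : ∀ n, (ρ n).rOut = η / (n + 1) := fun n => rfl
  have hrle : ∀ n, (ρ n).rOut ≤ η := fun n => by
    rw [hrout]
    exact div_le_self hη.le (by linarith [(Nat.cast_nonneg n : (0 : ℝ) ≤ n)])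
  have hrlim : Tendsto (fun n => (ρ n).rOut) atTop (𝓝 0) := by
    simp only [hrout]
    have := (tendsto_one_div_add_atTop_nhds_zero_nat (𝕜 := ℝ)).const_mul η
    simpa [div_eq_mul_inv] using this
  -- A bounded ratio of the radii is what the almost everywhere convergence of mollifications
  -- (Lebesgue differentiation) asks for.
  have hrr : ∀ᶠ n in atTop, (ρ n).rOut ≤ 2 * (ρ n).rIn := Eventually.of_forall fun n => by
    change η / (n + 1) ≤ 2 * (η / 2 / (n + 1))
    apply le_of_eq
    ring
  let F : ℕ → Plane → ℂ := fun n => (ρ n).normed volume ⋆[lsmul ℝ ℝ, volume] f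
  have hfd : ∀ n x, fderiv ℝ (F n) x =
      ((ρ n).normed volume ⋆[lsmul ℝ ℝ, volume] fderiv ℝ f) x := fun n x =>
    (hasFDerivAt_convolution_of_lipschitz (ρ n).continuous_normed
      (ρ n).hasCompactSupport_normed hf hd x).fderiv
  have hfder : ∀ x, ‖fderiv ℝ f x‖ ≤ K := fun x => norm_fderiv_le_of_lipschitz ℝ hf
  have hfderm : StronglyMeasurable (fderiv ℝ f) :=
    (measurable_fderiv ℝ f).stronglyMeasurable
  have hsupp : ∀ n, tsupport (F n) ⊆ Metric.cthickening η (tsupport f) := fun n => by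
    refine closure_minimal (fun x hx => ?_) Metric.isClosed_cthickening
    obtain ⟨a, ha, b, hb, rfl⟩ := support_convolution_subset (lsmul ℝ ℝ) hx
    rw [(ρ n).support_normed_eq] at ha
    refine Metric.mem_cthickening_of_dist_le _ b _ _ (subset_tsupport f hb) ?_
    simp only [dist_eq_norm, add_sub_cancel_right]
    exact (mem_ball_zero_iff.1 ha).le.trans (hrle n)
  have htest : ∀ n, IsTestFunction Ω (F n) := fun n =>
    { smooth := (ρ n).hasCompactSupport_normed.contDiff_convolution_left (lsmul ℝ ℝ)
        (ρ n).contDiff_normed hf.continuous.locallyIntegrable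
      compact := (hfs.isCompact.cthickening).of_isClosed_subset (isClosed_tsupport _) (hsupp n)
      support := (hsupp n).trans hηs }
  obtain ⟨B, hB⟩ := hf.continuous.bounded_above_of_compact_support hfs
  have hfm : MemLp f 2 (volume.restrict Ω) :=
    MemLp.of_bound hf.continuous.aestronglyMeasurable B (Eventually.of_forall hB)
  have hgb : ∀ x, ‖grad f x‖ ≤ ‖gradOf‖ * K := fun x =>
    gradOf.le_opNorm_of_le (hfder x)
  have hgm : MemLp (grad f) 2 (volume.restrict Ω) :=
    MemLp.of_bound (gradOf.continuous.comp_stronglyMeasurable hfderm).aestronglyMeasurable _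
      (Eventually.of_forall hgb)
  have hlim1 : Tendsto (fun n => (htest n).memLp.toLp (F n)) atTop (𝓝 (hfm.toLp f)) := by
    refine tendsto_toLp_of_bounded _ _ (fun n x => norm_normed_convolution_le (ρ n) hB x) ?_
    refine ae_restrict_of_ae ?_
    exact ContDiffBump.ae_convolution_tendsto_right_of_locallyIntegrable hrlim hrr
      hf.continuous.locallyIntegrable
  have hloc : LocallyIntegrable (fderiv ℝ f) := by
    refine (locallyIntegrable_const (K : ℝ)).mono hfderm.aestronglyMeasurable
      (Eventually.of_forall fun x => ?_)
    simpa using hfder x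
  have hlim2 : Tendsto (fun n => (htest n).memLp_grad.toLp (grad (F n))) atTop
      (𝓝 (hgm.toLp (grad f))) := by
    refine tendsto_toLp_of_bounded _ _ (B := ‖gradOf‖ * K) (fun n x => ?_) ?_
    · rw [grad_eq_gradOf, hfd]
      exact gradOf.le_opNorm_of_le (norm_normed_convolution_le (ρ n) hfder x)
    · refine ae_restrict_of_ae ?_
      filter_upwards [ContDiffBump.ae_convolution_tendsto_right_of_locallyIntegrable hrlim hrr
        hloc] with x hx
      simp only [grad_eq_gradOf, hfd]
      exact (gradOf.continuous.tendsto _).comp hx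
  refine ⟨⟨(hfm.toLp f, hgm.toLp (grad f)), ?_⟩, hgm.coeFn_toLp⟩
  exact mem_closure_of_tendsto (hlim1.prodMk_nhds hlim2)
    (Eventually.of_forall fun n => (htest n).mem_testPairs)

end HalfAnnulus

namespace HalfAnnulus

/-! ### Folding a test function across the boundary of a closed set -/

open Filter Topology

/-- A segment from a point of `C` to a point outside meets the frontier, where `h` vanishes;
comparing with that point keeps the constant `K`. -/
theorem lipschitzWith_indicator_of_frontier {E : Type*} [NormedAddCommGroup E] [NormedSpace ℝ E]
    {h : E → ℂ} {K : NNReal} (hh : LipschitzWith K h) {C : Set E}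
    (h0 : ∀ x ∈ frontier C, h x = 0) : LipschitzWith K (C.indicator h) := by
  have key : ∀ x ∈ C, ∀ y ∉ C, ‖h x‖ ≤ K * dist x y := by
    intro x hx y hy
    obtain ⟨z, hz, hzf⟩ : (segment ℝ x y ∩ frontier C).Nonempty := by
      by_contra hne
      have hfr : ∀ z ∈ segment ℝ x y, z ∉ frontier C := fun z hz hzf => hne ⟨z, hz, hzf⟩
      obtain ⟨z, -, hz1, hz2⟩ := (convex_segment x y).isPreconnected (interior C) (closure C)ᶜ
        isOpen_interior isClosed_closure.isOpen_compl
        (fun z hz => by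
          by_cases hzC : z ∈ closure C
          · exact Or.inl (by_contra fun hzi => hfr z hz ⟨hzC, hzi⟩)
          · exact Or.inr hzC)
        ⟨x, left_mem_segment ℝ x y, by_contra fun hxi =>
          hfr x (left_mem_segment ℝ x y) ⟨subset_closure hx, hxi⟩⟩
        ⟨y, right_mem_segment ℝ x y, fun hyc =>
          hfr y (right_mem_segment ℝ x y) ⟨hyc, fun hyi => hy (interior_subset hyi)⟩⟩
      exact hz2 (subset_closure (interior_subset hz1))
    have h1 := hh.dist_le_mul x z
    rw [h0 z hzf, dist_zero_right] at h1
    refine h1.trans (mul_le_mul_of_nonneg_left ?_ K.2)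
    have := dist_add_dist_of_mem_segment hz
    linarith [dist_nonneg (x := z) (y := y)]
  refine LipschitzWith.of_dist_le_mul fun x y => ?_
  by_cases hx : x ∈ C <;> by_cases hy : y ∈ C
  · simpa [hx, hy] using hh.dist_le_mul x y
  · simpa [hx, hy] using key x hx y hy
  · simpa [hx, hy, dist_comm] using key y hy x hx
  · simp only [indicator_of_notMem hx, indicator_of_notMem hy, dist_self]
    positivity

/-- Replacing `φ` by `2ψ - φ` on a closed set `C`, where `ψ = φ` on the boundary of `C`. -/
theorem exists_H10_fold {Ω : Set Plane} (hΩ : IsOpen Ω) (hvol : volume Ω ≠ ⊤) {φ ψ : Plane → ℂ}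
    (hφ : IsTestFunction Ω φ) (hψ : ContDiff ℝ ∞ ψ) (hψs : HasCompactSupport ψ) {C : Set Plane}
    (hC : IsClosed C) (hCvol : volume (frontier C) = 0) (hψφ : ∀ x ∈ frontier C, ψ x = φ x)
    (hψC : C ∩ tsupport ψ ⊆ Ω) :
    ∃ v : H10 Ω, (∀ᵐ x ∂volume.restrict Ω, x ∈ C →
        v.gradient x = (2 : ℂ) • grad ψ x - grad φ x) ∧
      ∀ᵐ x ∂volume.restrict Ω, x ∉ C → v.gradient x = grad φ x := by
  -- `h` is the difference between `2ψ - φ` and `φ`. It vanishes on the frontier of `C`, so cutting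
  -- it off there stays Lipschitz.
  set h : Plane → ℂ := (2 : ℂ) • (ψ - φ) with hh
  set f : Plane → ℂ := φ + C.indicator h with hf
  obtain ⟨K, hK⟩ := (contDiff_const.smul (hψ.sub hφ.smooth) : ContDiff ℝ ∞ h)
    |>.lipschitzWith_of_hasCompactSupport
      (hψs.sub hφ.compact).smul_left (by simp)
  obtain ⟨K', hK'⟩ := hφ.smooth.lipschitzWith_of_hasCompactSupport hφ.compact (by simp)
  have hlip : LipschitzWith (K' + K) f :=
    hK'.add (lipschitzWith_indicator_of_frontier hK fun x hx => by simp [hψφ x hx])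
  have hfC : ∀ x ∈ C, f x = 2 * ψ x - φ x := fun x hx => by
    simp only [hf, hh, Pi.add_apply, indicator_of_mem hx, Pi.smul_apply, Pi.sub_apply, smul_eq_mul]
    ring
  have hfC' : ∀ x ∉ C, f x = φ x := fun x hx => by simp [hf, hx]
  have hsub : tsupport f ⊆ tsupport φ ∪ (C ∩ tsupport ψ) := by
    refine closure_minimal (fun x hx => ?_)
      ((isClosed_tsupport φ).union (hC.inter (isClosed_tsupport ψ)))
    by_cases hφx : φ x = 0
    · have hxC : x ∈ C := by
        by_contra hxC
        exact hx ((hfC' x hxC).trans hφx)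
      refine Or.inr ⟨hxC, subset_tsupport ψ fun hψx => hx ?_⟩
      rw [hfC x hxC, hφx, hψx]
      ring
    · exact Or.inl (subset_tsupport φ hφx)
  have hcs : HasCompactSupport f :=
    (hφ.compact.isCompact.union (hψs.isCompact.inter_left hC)).of_isClosed_subset
      (isClosed_tsupport _) hsub
  have hdψ := hψ.differentiable (by simp)
  have hdφ := hφ.smooth.differentiable (by simp)
  have hin : ∀ x ∈ interior C, HasFDerivAt f ((2 : ℂ) • fderiv ℝ ψ x - fderiv ℝ φ x) x := by
    intro x hx
    have hev : f =ᶠ[𝓝 x] fun x => (2 : ℂ) • ψ x - φ x := by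
      filter_upwards [isOpen_interior.mem_nhds hx] with y hy
      rw [hfC y (interior_subset hy), smul_eq_mul]
    exact (((hdψ x).hasFDerivAt.const_smul (2 : ℂ)).sub (hdφ x).hasFDerivAt).congr_of_eventuallyEq
      hev
  have hout : ∀ x ∉ C, HasFDerivAt f (fderiv ℝ φ x) x := by
    intro x hx
    refine (hdφ x).hasFDerivAt.congr_of_eventuallyEq ?_
    filter_upwards [hC.isOpen_compl.mem_nhds hx] with y hy
    exact hfC' y hy
  have hae : ∀ᵐ x : Plane, x ∉ frontier C := measure_eq_zero_iff_ae_notMem.1 hCvol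
  have hint : ∀ x, x ∉ frontier C → x ∈ C → x ∈ interior C := fun x hx hxC => by
    by_contra hxi
    exact hx ⟨subset_closure hxC, hxi⟩
  obtain ⟨v, hv⟩ := exists_H10_of_lipschitz hΩ hvol hlip hcs
    (hsub.trans (union_subset hφ.support hψC)) (by
      filter_upwards [hae] with x hx
      by_cases hxC : x ∈ C
      · exact (hin x (hint x hx hxC)).differentiableAt
      · exact (hout x hxC).differentiableAt)
  refine ⟨v, ?_, ?_⟩
  · filter_upwards [hv, ae_restrict_of_ae hae] with x hx hxf hxC
    rw [hx]
    ext i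
    simp [grad, (hin x (hint x hxf hxC)).fderiv]
  · filter_upwards [hv] with x hx hxC
    rw [hx, grad_eq_gradOf, (hout x hxC).fderiv, grad_eq_gradOf]

/-! ### The energy estimate -/

theorem young_inner {E : Type*} [NormedAddCommGroup E] [InnerProductSpace ℂ E] (p q : E) {η : ℝ}
    (hη : 0 < η) : 2 * (inner ℂ p q).re ≤ η * ‖q‖ ^ 2 + ‖p‖ ^ 2 / η := by
  have h1 : (inner ℂ p q).re ≤ ‖p‖ * ‖q‖ := re_inner_le_norm (𝕜 := ℂ) p q
  have h2 : 2 * (‖p‖ * ‖q‖) ≤ η * ‖q‖ ^ 2 + ‖p‖ ^ 2 / η := by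
    have h3 : η * ‖q‖ ^ 2 + ‖p‖ ^ 2 / η - 2 * (‖p‖ * ‖q‖) = (η * ‖q‖ - ‖p‖) ^ 2 / η := by
      field_simp
      ring
    have : 0 ≤ (η * ‖q‖ - ‖p‖) ^ 2 / η := by positivity
    linarith
  linarith

theorem norm_two_smul_sub_sq_le {E : Type*} [NormedAddCommGroup E] [InnerProductSpace ℂ E]
    (p q : E) : ‖(2 : ℂ) • p - q‖ ^ 2 ≤ 8 * ‖p‖ ^ 2 + 2 * ‖q‖ ^ 2 := by
  have h : ‖(2 : ℂ) • p - q‖ ≤ 2 * ‖p‖ + ‖q‖ := by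
    refine (norm_sub_le _ _).trans ?_
    rw [norm_smul]
    simp
  have := pow_le_pow_left₀ (norm_nonneg _) h 2
  nlinarith [sq_nonneg (2 * ‖p‖ - ‖q‖)]

/-- Lower bound for `A` at a test function that can be folded across the boundary of `C`, when the
energy of the fold is controlled by the contrast. -/
theorem exists_bound_of_fold {a b N : ℝ} (ha : 0 < a) (hb : 0 < b) (hN : 0 < N) (hab : N * b < a) :
    ∃ c : ℝ, 0 < c ∧ ∀ (σp σm δ s : ℝ) (C : Set Plane) (φ ψ : Plane → ℂ)
      (hφ : IsTestFunction (Omega δ) φ) (v : H10 (Omega δ)), |s| = 1 → MeasurableSet C →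
      (∀ᵐ x ∂volume.restrict (Omega δ), x ∈ C →
        sigma σp σm δ x = -(s * b) ∧ v.gradient x = (2 : ℂ) • grad ψ x - grad φ x) →
      (∀ᵐ x ∂volume.restrict (Omega δ), x ∉ C →
        sigma σp σm δ x = s * a ∧ v.gradient x = grad φ x) →
      Integrable (fun x => ‖grad ψ x‖ ^ 2) →
      ∫ x in Omega δ ∩ C, ‖grad ψ x‖ ^ 2 ≤ N * ∫ x in Omega δ \ C, ‖grad φ x‖ ^ 2 →
      ‖hφ.toH10‖ ≤ c * ‖A σp σm δ hφ.toH10‖ := by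
  -- `η` is the Young parameter: `η < 1` leaves energy on `C`, and `N b / a < η` leaves energy off
  -- `C`.
  obtain ⟨η, hη0, hη1⟩ : ∃ η : ℝ, N * b / a < η ∧ η < 1 := exists_between ((div_lt_one ha).2 hab)
  have hη : 0 < η := lt_trans (by positivity) hη0
  have hm1 : 0 < a - N * b / η := by
    rw [sub_pos, div_lt_iff₀ hη]
    rw [div_lt_iff₀ ha] at hη0
    linarith
  have hm2 : 0 < b * (1 - η) := mul_pos hb (by linarith)
  set m := min (a - N * b / η) (b * (1 - η)) with hm
  have hmpos : 0 < m := lt_min hm1 hm2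
  set D := √(2 + 8 * N) with hD
  have hDpos : 0 < D := Real.sqrt_pos.2 (by linarith)
  refine ⟨D / m, by positivity, ?_⟩
  -- The constant is fixed before `δ`, whence uniformity. The sign `s` records which side of the
  -- interface dominates.
  intro σp σm δ s C φ ψ hφ v hs hC hin hout hψint hψφ
  have hss : s * s = 1 := by rw [← abs_mul_abs_self, hs, one_mul]
  have hgrad := hφ.gradient_toH10
  have hφint := hφ.integrable_norm_grad_sq
  set EP := ∫ x in Omega δ \ C, ‖grad φ x‖ ^ 2
  set EC := ∫ x in Omega δ ∩ C, ‖grad φ x‖ ^ 2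
  set F := ∫ x in Omega δ ∩ C, ‖grad ψ x‖ ^ 2
  have hEP : 0 ≤ EP := integral_nonneg fun x => by positivity
  have hEC : 0 ≤ EC := integral_nonneg fun x => by positivity
  have hle1 : volume.restrict (Omega δ ∩ C) ≤ volume.restrict (Omega δ) :=
    Measure.restrict_mono inter_subset_left le_rfl
  have hle2 : volume.restrict (Omega δ \ C) ≤ volume.restrict (Omega δ) :=
    Measure.restrict_mono sdiff_subset le_rfl
  have hmΩ : MeasurableSet (Omega δ) := measurableSet_sector _ _ _
  have hmem1 : ∀ᵐ x ∂volume.restrict (Omega δ ∩ C), x ∈ Omega δ ∩ C :=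
    ae_restrict_mem (hmΩ.inter hC)
  have hmem2 : ∀ᵐ x ∂volume.restrict (Omega δ \ C), x ∈ Omega δ \ C :=
    ae_restrict_mem (hmΩ.diff hC)
  have hnormφ : ‖hφ.toH10‖ ^ 2 = EC + EP := by
    have h : ∫ x in Omega δ, ‖hφ.toH10.gradient x‖ ^ 2 = ∫ x in Omega δ, ‖grad φ x‖ ^ 2 :=
      integral_congr_ae (hgrad.mono fun x hx => by simp only [hx])
    rw [H10.norm_def, Lp_norm_sq_eq_integral, h, ← integral_inter_add_sdiff hC hφint.integrableOn]
  have hvint : IntegrableOn (fun x => ‖v.gradient x‖ ^ 2) (Omega δ) :=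
    (Lp.memLp v.gradient).integrable_norm_pow two_ne_zero
  have hnormv : ‖v‖ ^ 2 ≤ (2 + 8 * N) * ‖hφ.toH10‖ ^ 2 := by
    have h1 : ∫ x in Omega δ ∩ C, ‖v.gradient x‖ ^ 2 ≤ 8 * F + 2 * EC := by
      rw [← integral_const_mul, ← integral_const_mul, ← integral_add
        (hψint.integrableOn.const_mul _) (hφint.integrableOn.const_mul _)]
      refine integral_mono_ae (hvint.mono_set inter_subset_left)
        ((hψint.integrableOn.const_mul _).add (hφint.integrableOn.const_mul _)) ?_
      filter_upwards [hmem1, ae_mono hle1 hin] with x hx h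
      rw [(h hx.2).2]
      exact norm_two_smul_sub_sq_le _ _
    have h2 : ∫ x in Omega δ \ C, ‖v.gradient x‖ ^ 2 = EP := by
      refine integral_congr_ae ?_
      filter_upwards [hmem2, ae_mono hle2 hout] with x hx h
      rw [(h hx.2).2]
    rw [hnormφ, H10.norm_def, Lp_norm_sq_eq_integral, ← integral_inter_add_sdiff hC hvint, h2]
    nlinarith [mul_nonneg hN.le hEC]
  have hlow : m * ‖hφ.toH10‖ ^ 2 ≤ s * (A σp σm δ hφ.toH10 v).re := by
    have hI := integrable_form σp σm δ hφ.toH10 v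
    have hre : IntegrableOn (fun x => s * ((sigma σp σm δ x : ℂ) *
        inner ℂ (v.gradient x) (hφ.toH10.gradient x)).re) (Omega δ) := hI.re.const_mul s
    have hform : s * (A σp σm δ hφ.toH10 v).re = ∫ x in Omega δ, s * ((sigma σp σm δ x : ℂ) *
        inner ℂ (v.gradient x) (hφ.toH10.gradient x)).re := by
      rw [A_apply, integral_const_mul]
      congr 1
      exact (integral_re hI).symm
    have h1 : b * (1 - η) * EC - b / η * F ≤ ∫ x in Omega δ ∩ C, s * ((sigma σp σm δ x : ℂ) *
        inner ℂ (v.gradient x) (hφ.toH10.gradient x)).re := by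
      rw [← integral_const_mul, ← integral_const_mul, ← integral_sub
        (hφint.integrableOn.const_mul _) (hψint.integrableOn.const_mul _)]
      refine integral_mono_ae
        ((hφint.integrableOn.const_mul _).sub (hψint.integrableOn.const_mul _))
        (hre.mono_set inter_subset_left) ?_
      filter_upwards [hmem1, ae_mono hle1 hin, ae_mono hle1 hgrad] with x hx h hg
      rw [(h hx.2).1, (h hx.2).2, hg, Complex.re_ofReal_mul, inner_sub_left, inner_smul_left,
        inner_self_eq_norm_sq_to_K]
      have hy := young_inner (grad ψ x) (grad φ x) hη
      have e1 : ((starRingEnd ℂ) 2 * inner ℂ (grad ψ x) (grad φ x) -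
          ((‖grad φ x‖ : ℝ) : ℂ) ^ 2).re =
          2 * (inner ℂ (grad ψ x) (grad φ x)).re - ‖grad φ x‖ ^ 2 := by
        rw [← Complex.ofReal_pow, Complex.sub_re, Complex.ofReal_re]
        simp
      have e2 : s * (-(s * b) * (2 * (inner ℂ (grad ψ x) (grad φ x)).re - ‖grad φ x‖ ^ 2)) =
          b * (‖grad φ x‖ ^ 2 - 2 * (inner ℂ (grad ψ x) (grad φ x)).re) := by
        linear_combination (-b * (2 * (inner ℂ (grad ψ x) (grad φ x)).re - ‖grad φ x‖ ^ 2)) * hss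
      refine le_trans ?_ (le_of_eq (e2.symm.trans (by rw [← e1]; rfl)))
      have e3 : b * (1 - η) * ‖grad φ x‖ ^ 2 - b / η * ‖grad ψ x‖ ^ 2 =
          b * (‖grad φ x‖ ^ 2 - (η * ‖grad φ x‖ ^ 2 + ‖grad ψ x‖ ^ 2 / η)) := by ring
      rw [e3]
      gcongr
    have h2 : ∫ x in Omega δ \ C, s * ((sigma σp σm δ x : ℂ) *
        inner ℂ (v.gradient x) (hφ.toH10.gradient x)).re = a * EP := by
      rw [← integral_const_mul]
      refine integral_congr_ae ?_
      filter_upwards [hmem2, ae_mono hle2 hout, ae_mono hle2 hgrad] with x hx h hg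
      rw [(h hx.2).1, (h hx.2).2, hg, Complex.re_ofReal_mul, inner_self_eq_norm_sq_to_K]
      have e1 : (((‖grad φ x‖ : ℝ) : ℂ) ^ 2).re = ‖grad φ x‖ ^ 2 := by
        rw [← Complex.ofReal_pow, Complex.ofReal_re]
      refine Eq.trans (congrArg (fun t => s * (s * a * t)) e1) ?_
      linear_combination (a * ‖grad φ x‖ ^ 2) * hss
    rw [hform, ← integral_inter_add_sdiff hC hre, h2, hnormφ]
    have h3 : b / η * F ≤ b / η * (N * EP) := mul_le_mul_of_nonneg_left hψφ (by positivity)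
    have h4 : m * EC ≤ b * (1 - η) * EC := mul_le_mul_of_nonneg_right (min_le_right _ _) hEC
    have h5 : m * EP ≤ (a - N * b / η) * EP := mul_le_mul_of_nonneg_right (min_le_left _ _) hEP
    have h6 : (a - N * b / η) * EP = a * EP - b / η * (N * EP) := by ring
    linarith
  have hup : s * (A σp σm δ hφ.toH10 v).re ≤ ‖A σp σm δ hφ.toH10‖ * ‖v‖ := by
    refine (le_abs_self _).trans ?_
    rw [abs_mul, hs, one_mul]
    exact (Complex.abs_re_le_norm _).trans ((A σp σm δ hφ.toH10).le_opNorm v)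
  have hvD : ‖v‖ ≤ D * ‖hφ.toH10‖ := by
    refine (sq_le_sq₀ (norm_nonneg _) (by positivity)).1 ?_
    rw [mul_pow, hD, Real.sq_sqrt (by linarith)]
    exact hnormv
  have hfin : m * ‖hφ.toH10‖ ^ 2 ≤ ‖A σp σm δ hφ.toH10‖ * (D * ‖hφ.toH10‖) :=
    (hlow.trans hup).trans (mul_le_mul_of_nonneg_left hvD (norm_nonneg _))
  rcases (norm_nonneg hφ.toH10).eq_or_lt with h0 | h0
  · rw [← h0]
    positivity
  · rw [div_mul_eq_mul_div, le_div_iff₀ hmpos]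
    refine le_of_mul_le_mul_right ?_ h0
    linarith

end HalfAnnulus

namespace HalfAnnulus

/-! ### The half-annulus in Cartesian coordinates -/

open Filter Topology

theorem sin_sub_cos (θ : ℝ) : Real.sin θ - Real.cos θ = √2 * Real.sin (θ - Real.pi / 4) := by
  rw [Real.sin_sub, Real.cos_pi_div_four, Real.sin_pi_div_four]
  have h : √2 * √2 = 2 := Real.mul_self_sqrt (by norm_num)
  linear_combination (-(Real.sin θ - Real.cos θ) / 2) * h

theorem cos_lt_sin {θ : ℝ} (h1 : Real.pi / 4 < θ) (h2 : θ < Real.pi) :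
    Real.cos θ < Real.sin θ := by
  have := Real.sin_pos_of_pos_of_lt_pi (x := θ - Real.pi / 4) (by linarith)
    (by linarith [Real.pi_pos])
  have h := sin_sub_cos θ
  have : 0 < √2 * Real.sin (θ - Real.pi / 4) := by positivity
  linarith

theorem sin_lt_cos {θ : ℝ} (h1 : 0 < θ) (h2 : θ < Real.pi / 4) : Real.sin θ < Real.cos θ := by
  have := Real.sin_neg_of_neg_of_neg_pi_lt (x := θ - Real.pi / 4) (by linarith)
    (by linarith [Real.pi_pos])
  have h := sin_sub_cos θ
  have : √2 * Real.sin (θ - Real.pi / 4) < 0 := mul_neg_of_pos_of_neg (by positivity) this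
  linarith

theorem exists_polar {δ : ℝ} (hδ : 0 < δ) {x : Plane} (h1 : δ ^ 2 < x 0 ^ 2 + x 1 ^ 2)
    (h2 : x 0 ^ 2 + x 1 ^ 2 < 1) (h3 : 0 < x 1) :
    ∃ r ∈ Ioo δ 1, ∃ θ ∈ Ioo 0 Real.pi, x 0 = r * Real.cos θ ∧ x 1 = r * Real.sin θ := by
  set r := √(x 0 ^ 2 + x 1 ^ 2) with hr
  have hrr : r ^ 2 = x 0 ^ 2 + x 1 ^ 2 := Real.sq_sqrt (by positivity)
  have hr1 : δ < r := Real.lt_sqrt_of_sq_lt h1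
  have hr0 : 0 < r := hδ.trans hr1
  have hr2 : r < 1 := by nlinarith
  have hx0 : |x 0| ≤ r := abs_le_of_sq_le_sq (by nlinarith) hr0.le
  have hb := abs_le.1 hx0
  have hc : Real.cos (Real.arccos (x 0 / r)) = x 0 / r :=
    Real.cos_arccos (by rw [le_div_iff₀ hr0]; linarith) (by rw [div_le_one hr0]; linarith)
  have hs : Real.sin (Real.arccos (x 0 / r)) = x 1 / r := by
    rw [Real.sin_arccos, Real.sqrt_eq_iff_eq_sq _ (by positivity)]
    · field_simp
      linarith
    · rw [sub_nonneg, div_pow, div_le_one (by positivity)]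
      nlinarith
  have hspos : 0 < Real.sin (Real.arccos (x 0 / r)) := by rw [hs]; positivity
  refine ⟨r, ⟨hr1, hr2⟩, Real.arccos (x 0 / r), ⟨?_, ?_⟩, ?_, ?_⟩
  · refine (Real.arccos_nonneg _).lt_of_ne fun h => ?_
    rw [← h, Real.sin_zero] at hspos
    exact hspos.false
  · refine (Real.arccos_le_pi _).lt_of_ne fun h => ?_
    rw [h, Real.sin_pi] at hspos
    exact hspos.false
  · rw [hc]; field_simp
  · rw [hs]; field_simp

theorem mem_sector {δ α β : ℝ} {x : Plane} : x ∈ sector δ α β ↔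
    ∃ r ∈ Ioo δ 1, ∃ θ ∈ Ioo α β, x 0 = r * Real.cos θ ∧ x 1 = r * Real.sin θ := by
  constructor
  · rintro ⟨⟨r, θ⟩, ⟨hr, hθ⟩, rfl⟩
    exact ⟨r, hr, θ, hθ, rfl, rfl⟩
  · rintro ⟨r, hr, θ, hθ, h0, h1⟩
    refine ⟨(r, θ), ⟨hr, hθ⟩, ?_⟩
    ext i
    fin_cases i
    · exact h0.symm
    · exact h1.symm

theorem mem_Omega {δ : ℝ} (hδ : 0 < δ) {x : Plane} : x ∈ Omega δ ↔
    δ ^ 2 < x 0 ^ 2 + x 1 ^ 2 ∧ x 0 ^ 2 + x 1 ^ 2 < 1 ∧ 0 < x 1 := by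
  rw [Omega, mem_sector]
  constructor
  · rintro ⟨r, ⟨hr1, hr2⟩, θ, ⟨hθ1, hθ2⟩, h0, h1⟩
    have hs := Real.sin_pos_of_pos_of_lt_pi hθ1 hθ2
    have hr0 := hδ.trans hr1
    have hsq : x 0 ^ 2 + x 1 ^ 2 = r ^ 2 := by
      rw [h0, h1]
      linear_combination r ^ 2 * Real.sin_sq_add_cos_sq θ
    rw [hsq]
    refine ⟨by nlinarith, by nlinarith, ?_⟩
    rw [h1]
    positivity
  · rintro ⟨h1, h2, h3⟩
    exact exists_polar hδ h1 h2 h3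

theorem sigma_of_lt {σp σm δ : ℝ} (hδ : 0 < δ) {x : Plane} (hx : x ∈ Omega δ) (h : x 0 < x 1) :
    sigma σp σm δ x = σp := by
  obtain ⟨r, hr, θ, hθ, h0, h1⟩ := mem_sector.1 hx
  have hr0 : 0 < r := hδ.trans hr.1
  rw [h0, h1, mul_lt_mul_iff_right₀ hr0] at h
  refine if_pos (mem_sector.2 ⟨r, hr, θ, ⟨?_, hθ.2⟩, h0, h1⟩)
  by_contra hle
  rcases (not_lt.1 hle).lt_or_eq with hlt | heq
  · exact (sin_lt_cos hθ.1 hlt).not_gt h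
  · rw [heq, Real.cos_pi_div_four, Real.sin_pi_div_four] at h
    exact h.false

theorem sigma_of_gt {σp σm δ : ℝ} (hδ : 0 < δ) {x : Plane} (hx : x ∈ Omega δ) (h : x 1 < x 0) :
    sigma σp σm δ x = σm := by
  have hn : x ∉ OmegaPlus δ := by
    intro hp
    obtain ⟨r, hr, θ, hθ, h0, h1⟩ := mem_sector.1 hp
    have hr0 : 0 < r := hδ.trans hr.1
    rw [h0, h1, mul_lt_mul_iff_right₀ hr0] at h
    exact (cos_lt_sin hθ.1 hθ.2).not_gt h
  obtain ⟨r, hr, θ, hθ, h0, h1⟩ := mem_sector.1 hx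
  have hr0 : 0 < r := hδ.trans hr.1
  rw [h0, h1, mul_lt_mul_iff_right₀ hr0] at h
  rw [sigma, if_neg hn]
  refine if_pos (mem_sector.2 ⟨r, hr, θ, ⟨hθ.1, ?_⟩, h0, h1⟩)
  by_contra hle
  rcases (not_lt.1 hle).lt_or_eq with hlt | heq
  · exact (cos_lt_sin hlt hθ.2).not_gt h
  · rw [← heq, Real.cos_pi_div_four, Real.sin_pi_div_four] at h
    exact h.false

theorem continuous_coord (i : Fin 2) : Continuous fun x : Plane => x i := by fun_prop

theorem isOpen_Omega {δ : ℝ} (hδ : 0 < δ) : IsOpen (Omega δ) := by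
  have h : Omega δ = {x : Plane | δ ^ 2 < x 0 ^ 2 + x 1 ^ 2} ∩
      ({x : Plane | x 0 ^ 2 + x 1 ^ 2 < 1} ∩ {x : Plane | 0 < x 1}) := by
    ext x
    exact mem_Omega hδ
  rw [h]
  exact (isOpen_lt (by fun_prop) (by fun_prop)).inter
    ((isOpen_lt (by fun_prop) (by fun_prop)).inter (isOpen_lt (by fun_prop) (by fun_prop)))

theorem norm_sq_eq_coord (x : Plane) : ‖x‖ ^ 2 = x 0 ^ 2 + x 1 ^ 2 := by
  rw [EuclideanSpace.real_norm_sq_eq, Fin.sum_univ_two]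

theorem volume_Omega_ne_top {δ : ℝ} (hδ : 0 < δ) : volume (Omega δ) ≠ ⊤ := by
  refine ((measure_mono (t := Metric.ball 0 1) fun x hx => ?_).trans_lt measure_ball_lt_top).ne
  have h := ((mem_Omega hδ).1 hx).2.1
  rw [← norm_sq_eq_coord] at h
  rw [mem_ball_zero_iff]
  nlinarith [norm_nonneg x]

theorem abs_coord_le_of_mem_Omega {δ : ℝ} (hδ : 0 < δ) {x : Plane} (hx : x ∈ Omega δ) :
    |x 0| ≤ 1 := by
  have h := ((mem_Omega hδ).1 hx).2.1
  exact abs_le_of_sq_le_sq (by nlinarith [sq_nonneg (x 1)]) zero_le_one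

theorem volume_ker_eq_zero {ℓ : Plane →ₗ[ℝ] ℝ} (h : ℓ ≠ 0) : volume {x | ℓ x = 0} = 0 := by
  have := Measure.addHaar_submodule (volume : Measure Plane) (LinearMap.ker ℓ)
    (fun ht => h (LinearMap.ker_eq_top.1 ht))
  exact this

theorem volume_axis : volume {x : Plane | x 1 = 0} = 0 :=
  volume_ker_eq_zero (ℓ := (EuclideanSpace.proj 1 : Plane →L[ℝ] ℝ).toLinearMap) fun h => by
    simpa using LinearMap.congr_fun h (EuclideanSpace.single 1 1)

theorem volume_diagonal : volume {x : Plane | x 0 = x 1} = 0 := by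
  have h := volume_ker_eq_zero (ℓ := (EuclideanSpace.proj 0 : Plane →L[ℝ] ℝ).toLinearMap -
    (EuclideanSpace.proj 1 : Plane →L[ℝ] ℝ).toLinearMap) fun h => by
    simpa using LinearMap.congr_fun h (EuclideanSpace.single 0 1)
  simpa [sub_eq_zero] using h

/-! ### Change of variables in the Dirichlet energy -/

theorem sum_sq_apply_single (ℓ : Plane →L[ℝ] ℝ) :
    ∑ i, ℓ (EuclideanSpace.single i 1) ^ 2 = ‖ℓ‖ ^ 2 := by
  set y := (InnerProductSpace.toDual ℝ Plane).symm ℓ with hy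
  have h1 : ∀ i, ℓ (EuclideanSpace.single i 1) = y i := fun i => by
    rw [← InnerProductSpace.toDual_symm_apply (x := EuclideanSpace.single i 1) (y := ℓ), ← hy]
    simp [EuclideanSpace.inner_single_right]
  have h2 : ‖ℓ‖ = ‖y‖ := by rw [hy, LinearIsometryEquiv.norm_map]
  rw [h2, EuclideanSpace.real_norm_sq_eq]
  exact Finset.sum_congr rfl fun i _ => by rw [h1]

theorem norm_gradOf_sq (T : Plane →L[ℝ] ℂ) :
    ‖gradOf T‖ ^ 2 = ‖Complex.reCLM.comp T‖ ^ 2 + ‖Complex.imCLM.comp T‖ ^ 2 := by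
  rw [← sum_sq_apply_single, ← sum_sq_apply_single, ← Finset.sum_add_distrib,
    EuclideanSpace.norm_sq_eq]
  refine Finset.sum_congr rfl fun i _ => ?_
  have h : gradOf T i = T (EuclideanSpace.single i 1) := rfl
  rw [h, ← Complex.normSq_eq_norm_sq, Complex.normSq_apply]
  simp only [ContinuousLinearMap.comp_apply, Complex.reCLM_apply, Complex.imCLM_apply]
  ring

/-- The gradient norm is the Hilbert–Schmidt norm of `T`. Splitting into real and imaginary parts
reduces it to operator norms of real functionals, which are submultiplicative. -/
theorem norm_gradOf_comp_sq_le (T : Plane →L[ℝ] ℂ) (M : Plane →L[ℝ] Plane) :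
    ‖gradOf (T.comp M)‖ ^ 2 ≤ ‖M‖ ^ 2 * ‖gradOf T‖ ^ 2 := by
  have key : ∀ ℓ : Plane →L[ℝ] ℝ, ‖ℓ.comp M‖ ^ 2 ≤ ‖M‖ ^ 2 * ‖ℓ‖ ^ 2 := fun ℓ => by
    rw [← mul_pow, mul_comm]
    exact pow_le_pow_left₀ (norm_nonneg _) (ℓ.opNorm_comp_le M) 2
  rw [norm_gradOf_sq, norm_gradOf_sq, ← ContinuousLinearMap.comp_assoc,
    ← ContinuousLinearMap.comp_assoc, mul_add]
  exact add_le_add (key _) (key _)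

/-- The chain rule costs `k ^ 2`, and the Jacobian of the change of variables gives back `1 / d`. -/
theorem setIntegral_norm_grad_comp_le {φ : Plane → ℂ} (hφ : Differentiable ℝ φ)
    (hφi : Integrable fun x => ‖grad φ x‖ ^ 2) {G : Plane → Plane} {G' : Plane → Plane →L[ℝ] Plane}
    {U : Set Plane} (hU : MeasurableSet U) (hG : ∀ x ∈ U, HasFDerivAt G (G' x) x)
    (hinj : InjOn G U) {k d : ℝ} (hd : 0 < d) (hk : ∀ x ∈ U, ‖G' x‖ ≤ k)
    (hdet : ∀ x ∈ U, |(G' x).det| = d) :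
    ∫ x in U, ‖grad (φ ∘ G) x‖ ^ 2 ≤ k ^ 2 / d * ∫ x in G '' U, ‖grad φ x‖ ^ 2 := by
  have hGw : ∀ x ∈ U, HasFDerivWithinAt G (G' x) U x := fun x hx => (hG x hx).hasFDerivWithinAt
  have hint : IntegrableOn (fun x => d * ‖grad φ (G x)‖ ^ 2) U := by
    have := (integrableOn_image_iff_integrableOn_abs_det_fderiv_smul volume hU hGw hinj
      (fun x => ‖grad φ x‖ ^ 2)).1 hφi.integrableOn
    exact this.congr_fun (fun x hx => by simp only [hdet x hx, smul_eq_mul]) hU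
  have hcov : ∫ x in G '' U, ‖grad φ x‖ ^ 2 = ∫ x in U, d * ‖grad φ (G x)‖ ^ 2 := by
    rw [integral_image_eq_integral_abs_det_fderiv_smul volume hU hGw hinj]
    exact setIntegral_congr_fun hU fun x hx => by simp only [hdet x hx, smul_eq_mul]
  rw [hcov, ← integral_const_mul]
  refine integral_mono_of_nonneg (Eventually.of_forall fun x => by positivity)
    (hint.const_mul _) ?_
  filter_upwards [ae_restrict_mem hU] with x hx
  have hfd : fderiv ℝ (φ ∘ G) x = (fderiv ℝ φ (G x)).comp (G' x) :=
    ((hφ (G x)).hasFDerivAt.comp x (hG x hx)).fderiv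
  have e : k ^ 2 / d * (d * ‖grad φ (G x)‖ ^ 2) = k ^ 2 * ‖grad φ (G x)‖ ^ 2 := by
    field_simp
  rw [e, grad_eq_gradOf, hfd]
  refine (norm_gradOf_comp_sq_le _ _).trans ?_
  rw [grad_eq_gradOf]
  gcongr
  exact hk x hx

end HalfAnnulus

namespace HalfAnnulus

/-! ### Maps of the plane in complex notation -/

open Filter Topology ComplexConjugate

/-- The identification of the plane with `ℂ`. -/
noncomputable def toC : Plane ≃ₗᵢ[ℝ] ℂ := Complex.orthonormalBasisOneI.repr.symm

theorem toC_re (x : Plane) : (toC x).re = x 0 := by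
  simp [toC]

theorem toC_im (x : Plane) : (toC x).im = x 1 := by
  simp [toC]

/-- A map of `ℂ` read in the plane. -/
noncomputable def planeMap (g : ℂ → ℂ) (x : Plane) : Plane := toC.symm (g (toC x))

theorem planeMap_zero (g : ℂ → ℂ) (x : Plane) : planeMap g x 0 = (g (toC x)).re := by
  rw [← toC_re, planeMap, toC.apply_symm_apply]

theorem planeMap_one (g : ℂ → ℂ) (x : Plane) : planeMap g x 1 = (g (toC x)).im := by
  rw [← toC_im, planeMap, toC.apply_symm_apply]

/-- The real linear map `h ↦ a h + b h̄`. -/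
noncomputable def wirtinger (a b : ℂ) : ℂ →L[ℝ] ℂ :=
  a • (ContinuousLinearMap.id ℝ ℂ) + b • (Complex.conjCLE : ℂ →L[ℝ] ℂ)

theorem wirtinger_apply (a b h : ℂ) : wirtinger a b h = a * h + b * conj h := by
  simp [wirtinger]

theorem norm_wirtinger_le (a b : ℂ) : ‖wirtinger a b‖ ≤ ‖a‖ + ‖b‖ := by
  refine ContinuousLinearMap.opNorm_le_bound _ (by positivity) fun h => ?_
  rw [wirtinger_apply, add_mul]
  refine (norm_add_le _ _).trans (le_of_eq ?_)
  simp

theorem det_wirtinger (a b : ℂ) : (wirtinger a b).det = ‖a‖ ^ 2 - ‖b‖ ^ 2 := by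
  have h1 : (wirtinger a b).det = LinearMap.det (wirtinger a b : ℂ →ₗ[ℝ] ℂ) := rfl
  rw [h1, ← LinearMap.det_toMatrix Complex.basisOneI, Matrix.det_fin_two]
  simp only [LinearMap.toMatrix_apply, Complex.coe_basisOneI, Complex.coe_basisOneI_repr,
    ContinuousLinearMap.coe_coe, wirtinger_apply, ← Complex.normSq_eq_norm_sq,
    Complex.normSq_apply]
  simp
  ring

/-- `wirtinger a b` read in the plane. -/
noncomputable def planeWirtinger (a b : ℂ) : Plane →L[ℝ] Plane :=
  (toC.symm.toContinuousLinearEquiv : ℂ →L[ℝ] Plane).comp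
    ((wirtinger a b).comp (toC.toContinuousLinearEquiv : Plane →L[ℝ] ℂ))

theorem norm_planeWirtinger_le (a b : ℂ) : ‖planeWirtinger a b‖ ≤ ‖a‖ + ‖b‖ := by
  refine ContinuousLinearMap.opNorm_le_bound _ (by positivity) fun h => ?_
  have e : ‖planeWirtinger a b h‖ = ‖wirtinger a b (toC h)‖ := by
    simp [planeWirtinger]
  rw [e, ← toC.norm_map h]
  exact (wirtinger a b).le_of_opNorm_le (norm_wirtinger_le a b) _

theorem det_planeWirtinger (a b : ℂ) : (planeWirtinger a b).det = ‖a‖ ^ 2 - ‖b‖ ^ 2 := by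
  rw [← det_wirtinger]
  exact LinearMap.det_conj (wirtinger a b : ℂ →ₗ[ℝ] ℂ) toC.symm.toLinearEquiv

theorem hasFDerivAt_planeMap {g : ℂ → ℂ} {a b : ℂ} {x : Plane}
    (h : HasFDerivAt g (wirtinger a b) (toC x)) :
    HasFDerivAt (planeMap g) (planeWirtinger a b) x :=
  toC.symm.toContinuousLinearEquiv.hasFDerivAt.comp x
    (h.comp x toC.toContinuousLinearEquiv.hasFDerivAt)

theorem norm_planeMap {g : ℂ → ℂ} (hg : ∀ z, ‖g z‖ = ‖z‖) (x : Plane) :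
    ‖planeMap g x‖ = ‖x‖ := by
  rw [planeMap, toC.symm.norm_map, hg, toC.norm_map]

theorem continuous_planeMap {g : ℂ → ℂ} (hg : Continuous g) : Continuous (planeMap g) :=
  toC.symm.continuous.comp (hg.comp toC.continuous)

theorem tsupport_comp_subset {φ : Plane → ℂ} {G : Plane → Plane} (hG : Continuous G) :
    tsupport (φ ∘ G) ⊆ G ⁻¹' tsupport φ :=
  closure_minimal (fun _ hx => subset_tsupport φ hx) ((isClosed_tsupport φ).preimage hG)

theorem hasCompactSupport_comp {φ : Plane → ℂ} (hφ : HasCompactSupport φ) {G : Plane → Plane}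
    (hG : Continuous G) (hn : ∀ x, ‖G x‖ = ‖x‖) : HasCompactSupport (φ ∘ G) := by
  obtain ⟨R, hR⟩ := hφ.isCompact.isBounded.exists_norm_le
  refine (isCompact_closedBall (0 : Plane) R).of_isClosed_subset (isClosed_tsupport _) ?_
  intro x hx
  rw [mem_closedBall_zero_iff, ← hn]
  exact hR _ (tsupport_comp_subset hG hx)

/-! ### The two reflections -/

/-- Reflection across the diagonal. -/
noncomputable def swapMap (z : ℂ) : ℂ := Complex.I * conj z

theorem hasFDerivAt_swapMap (z : ℂ) : HasFDerivAt swapMap (wirtinger 0 Complex.I) z := by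
  have h := (Complex.conjCLE.hasFDerivAt (x := z)).const_smul Complex.I
  have e : wirtinger 0 Complex.I = Complex.I • (Complex.conjCLE : ℂ →L[ℝ] ℂ) := by
    ext h
    simp [wirtinger]
  rw [e]
  exact h

theorem norm_swapMap (z : ℂ) : ‖swapMap z‖ = ‖z‖ := by simp [swapMap]

theorem planeMap_swapMap_zero (x : Plane) : planeMap swapMap x 0 = x 1 := by
  rw [planeMap_zero]
  simp [swapMap, toC_im]

theorem planeMap_swapMap_one (x : Plane) : planeMap swapMap x 1 = x 0 := by
  rw [planeMap_one]
  simp [swapMap, toC_re]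

/-- In polar coordinates `(r, θ) ↦ (r, π - 3θ)`. -/
noncomputable def foldMap (z : ℂ) : ℂ := -(conj z) ^ 2 * z⁻¹

/-- Preserving the radius keeps the fold inside the annulus for every δ. At 0 it holds through the
convention `0⁻¹ = 0`. -/
theorem norm_foldMap (z : ℂ) : ‖foldMap z‖ = ‖z‖ := by
  rcases eq_or_ne z 0 with rfl | hz
  · simp [foldMap]
  · have : ‖z‖ ≠ 0 := norm_ne_zero_iff.2 hz
    simp only [foldMap, norm_mul, norm_neg, norm_pow, RCLike.norm_conj, norm_inv]
    field_simp

/-- The Wirtinger coefficients have moduli 1 and 2, so the operator norm is at most 3 and the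
determinant is 1 - 4 = -3. The ratio 9/3 = 3 is the source of the threshold -1/3. -/
theorem hasFDerivAt_foldMap {z : ℂ} (hz : z ≠ 0) :
    HasFDerivAt foldMap (wirtinger ((conj z / z) ^ 2) (-2 * (conj z / z))) z := by
  have h1 : HasFDerivAt (fun w : ℂ => -(conj w) ^ 2) _ z :=
    ((Complex.conjCLE.hasFDerivAt (x := z)).pow 2).neg
  have h2 : HasFDerivAt (fun w : ℂ => w⁻¹) _ z := (hasDerivAt_inv hz).hasFDerivAt.restrictScalars ℝ
  refine (h1.mul h2).congr_fderiv ?_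
  ext h
  all_goals
    rw [wirtinger_apply]
    simp
    field_simp
    try ring

theorem contDiffAt_foldMap {z : ℂ} (hz : z ≠ 0) : ContDiffAt ℝ ∞ foldMap z := by
  have h1 : ContDiffAt ℝ ∞ (fun w : ℂ => -(conj w) ^ 2) z :=
    ((Complex.conjCLE.contDiff.pow 2).neg).contDiffAt
  exact h1.mul (contDiffAt_inv ℝ hz)

theorem continuous_foldMap : Continuous foldMap := by
  rw [continuous_iff_continuousAt]
  intro z
  rcases eq_or_ne z 0 with rfl | hz
  · have h0 : foldMap 0 = 0 := by simp [foldMap]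
    rw [ContinuousAt, h0, tendsto_zero_iff_norm_tendsto_zero]
    simp only [norm_foldMap]
    simpa using (continuous_norm.tendsto (0 : ℂ))
  · exact (contDiffAt_foldMap hz).continuousAt

theorem planeMap_foldMap_zero (x : Plane) :
    planeMap foldMap x 0 = (3 * x 0 * x 1 ^ 2 - x 0 ^ 3) / (x 0 ^ 2 + x 1 ^ 2) := by
  rw [planeMap_zero]
  simp only [foldMap, Complex.mul_re, Complex.neg_re, Complex.neg_im, Complex.inv_re,
    Complex.inv_im, Complex.normSq_apply, pow_two, Complex.mul_im, Complex.conj_re,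
    Complex.conj_im, toC_re, toC_im]
  ring

theorem planeMap_foldMap_one (x : Plane) :
    planeMap foldMap x 1 = (3 * x 0 ^ 2 * x 1 - x 1 ^ 3) / (x 0 ^ 2 + x 1 ^ 2) := by
  rw [planeMap_one]
  simp only [foldMap, Complex.mul_re, Complex.neg_re, Complex.neg_im, Complex.inv_re,
    Complex.inv_im, Complex.normSq_apply, pow_two, Complex.mul_im, Complex.conj_re,
    Complex.conj_im, toC_re, toC_im]
  ring

/-- The interface angle solves π - 3θ = θ, so the fold glues continuously there. -/
theorem planeMap_foldMap_of_diagonal {x : Plane} (hx : x 0 = x 1) : planeMap foldMap x = x := by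
  ext i
  rcases eq_or_ne (x 1) 0 with h | h
  · fin_cases i
    · change planeMap foldMap x 0 = x 0
      rw [planeMap_foldMap_zero, hx, h]; simp
    · change planeMap foldMap x 1 = x 1
      rw [planeMap_foldMap_one, hx, h]; simp
  · fin_cases i
    · change planeMap foldMap x 0 = x 0
      rw [planeMap_foldMap_zero, hx]; field_simp; ring
    · change planeMap foldMap x 1 = x 1
      rw [planeMap_foldMap_one, hx]; field_simp; ring

/-- Equal images force equal moduli and then equal cubes. In this sector `z² + zw + w²` has positive
imaginary part, which leaves only `z = w`. -/
theorem foldMap_injOn : InjOn foldMap {z : ℂ | 0 < z.im ∧ z.im < z.re} := by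
  rintro z ⟨hz1, hz2⟩ w ⟨hw1, hw2⟩ h
  have hz : z ≠ 0 := fun h => by simp [h] at hz1
  have hw : w ≠ 0 := fun h => by simp [h] at hw1
  have hn : z * conj z = w * conj w := by
    rw [Complex.mul_conj, Complex.mul_conj, Complex.normSq_eq_norm_sq, Complex.normSq_eq_norm_sq,
      ← norm_foldMap z, h, norm_foldMap]
  have h3 : conj z ^ 3 = conj w ^ 3 := by
    simp only [foldMap] at h
    field_simp at h
    refine mul_left_cancel₀ hw ?_
    linear_combination (-conj z) * h + conj w ^ 2 * hn
  have h3' : z ^ 3 = w ^ 3 := by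
    have := congrArg conj h3
    simpa using this
  have hfac : (z - w) * (z ^ 2 + z * w + w ^ 2) = 0 := by linear_combination h3'
  rcases mul_eq_zero.1 hfac with h0 | h0
  · exact sub_eq_zero.1 h0
  · exfalso
    have him := congrArg Complex.im h0
    simp only [pow_two, Complex.add_im, Complex.mul_im, Complex.zero_im] at him
    have hzr := hz1.trans hz2
    have hwr := hw1.trans hw2
    have := mul_pos hzr hz1
    have := mul_pos hzr hw1
    have := mul_pos hwr hz1
    have := mul_pos hwr hw1
    linarith

end HalfAnnulus

/-! ### Energy of the folds and the δ-uniform lower bounds -/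

namespace HalfAnnulus

open Filter Topology

/-- The energy of `φ ∘ G` on `C`, when `G` maps the relevant part of `C` to the complement of `C`. -/
theorem setIntegral_fold_le {Ω : Set Plane} {φ : Plane → ℂ} (hφ : IsTestFunction Ω φ)
    {C O : Set Plane} (hΩ : MeasurableSet Ω) (hC : MeasurableSet C) (hO : MeasurableSet O)
    (hCO : Ω ∩ C ⊆ O ∪ {x | x 0 = x 1}) {G : Plane → Plane} {a b : Plane → ℂ}
    (hG : ∀ x ∈ Ω ∩ O, HasFDerivAt G (planeWirtinger (a x) (b x)) x) (hinj : InjOn G (Ω ∩ O))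
    {k d : ℝ} (hd : 0 < d) (hk : ∀ x ∈ Ω ∩ O, ‖a x‖ + ‖b x‖ ≤ k)
    (hdet : ∀ x ∈ Ω ∩ O, |‖a x‖ ^ 2 - ‖b x‖ ^ 2| = d) (hGO : ∀ x ∈ Ω ∩ O, G x ∉ C)
    (hψ : Integrable fun x => ‖grad (φ ∘ G) x‖ ^ 2) :
    ∫ x in Ω ∩ C, ‖grad (φ ∘ G) x‖ ^ 2 ≤ k ^ 2 / d * ∫ x in Ω \ C, ‖grad φ x‖ ^ 2 := by
  have hφi := hφ.integrable_norm_grad_sq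
  have h1 : ∫ x in Ω ∩ C, ‖grad (φ ∘ G) x‖ ^ 2 ≤ ∫ x in Ω ∩ O, ‖grad (φ ∘ G) x‖ ^ 2 := by
    refine setIntegral_mono_set hψ.integrableOn (Eventually.of_forall fun x => by positivity) ?_
    filter_upwards [measure_eq_zero_iff_ae_notMem.1 volume_diagonal] with x hx hxC
    exact ⟨hxC.1, (hCO hxC).resolve_right hx⟩
  have h2 := setIntegral_norm_grad_comp_le (hφ.smooth.differentiable (by simp)) hφi
    (hΩ.inter hO) hG hinj hd (fun x hx => (norm_planeWirtinger_le _ _).trans (hk x hx))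
    (fun x hx => by rw [det_planeWirtinger, hdet x hx])
  have h3 : ∫ x in G '' (Ω ∩ O), ‖grad φ x‖ ^ 2 ≤ ∫ x in Cᶜ, ‖grad φ x‖ ^ 2 := by
    refine setIntegral_mono_set hφi.integrableOn (Eventually.of_forall fun x => by positivity) ?_
    refine Eventually.of_forall ?_
    rintro _ ⟨x, hx, rfl⟩
    exact hGO x hx
  -- `G` may leave `Ω`, as the diagonal reflection does, but `φ` extended by zero has no energy
  -- there.
  have h4 : ∫ x in Cᶜ, ‖grad φ x‖ ^ 2 = ∫ x in Ω \ C, ‖grad φ x‖ ^ 2 := by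
    refine setIntegral_eq_of_subset_of_forall_sdiff_eq_zero hC.compl (fun x hx => hx.2) ?_
    rintro x ⟨hx1, hx2⟩
    have hx : x ∉ Ω := fun h => hx2 ⟨h, hx1⟩
    simp [hφ.grad_eq_zero_of_notMem hx]
  rw [h4] at h3
  exact h1.trans (h2.trans (mul_le_mul_of_nonneg_left h3 (by positivity)))

theorem integrable_norm_grad_sq_of_smooth {ψ : Plane → ℂ} (hψ : ContDiff ℝ ∞ ψ)
    (hs : HasCompactSupport ψ) : Integrable fun x => ‖grad ψ x‖ ^ 2 :=
  IsTestFunction.integrable_norm_grad_sq (Ω := univ) ⟨hψ, hs, subset_univ _⟩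

/-- The uniform bound when the negative coefficient dominates. -/
theorem exists_bound_of_lt_neg_one {σp σm : ℝ} (hσp : 0 < σp) (h : σp < -σm) :
    ∃ c : ℝ, 0 < c ∧ ∀ δ ∈ Ioo (0 : ℝ) 1, ∀ u : H10 (Omega δ), ‖u‖ ≤ c * ‖A σp σm δ u‖ := by
  obtain ⟨c, hc, hbound⟩ := exists_bound_of_fold (a := -σm) (b := σp) (N := 1) (by linarith) hσp
    one_pos (by linarith)
  refine ⟨c, hc, fun δ hδ => bound_of_bound_test fun φ hφ => ?_⟩
  have hΩo := isOpen_Omega hδ.1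
  have hGc : Continuous (planeMap swapMap) := continuous_planeMap
    (continuous_iff_continuousAt.2 fun z => (hasFDerivAt_swapMap z).continuousAt)
  have hψ : ContDiff ℝ ∞ (φ ∘ planeMap swapMap) := by
    refine hφ.smooth.comp (toC.symm.contDiff.comp ?_)
    exact (contDiff_const.mul Complex.conjCLE.contDiff).comp toC.contDiff
  have hψs := hasCompactSupport_comp hφ.compact hGc (norm_planeMap norm_swapMap)
  set C : Set Plane := {x | x 0 ≤ x 1} with hCdef
  have hC : IsClosed C := isClosed_le (by fun_prop) (by fun_prop)
  have hfr : frontier C ⊆ {x | x 0 = x 1} :=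
    frontier_le_subset_eq (continuous_coord 0) (continuous_coord 1)
  obtain ⟨v, hv1, hv2⟩ := exists_H10_fold hΩo (volume_Omega_ne_top hδ.1) hφ hψ hψs hC
    (measure_mono_null hfr volume_diagonal)
    (fun x hx => by
      have hd : x 0 = x 1 := hfr hx
      have : planeMap swapMap x = x := by
        ext i
        fin_cases i
        · exact (planeMap_swapMap_zero x).trans hd.symm
        · exact (planeMap_swapMap_one x).trans hd
      simp only [Function.comp_apply, this])
    -- On `C` the first coordinate of `x` is the second of its reflection, hence positive where `ψ`
    -- lives; then `x 1 ≥ x 0 > 0`.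
    (by
      rintro x ⟨hxC, hx⟩
      have h1 := (mem_Omega hδ.1).1 (hφ.support (tsupport_comp_subset hGc hx))
      rw [planeMap_swapMap_zero, planeMap_swapMap_one] at h1
      have hxC' : x 0 ≤ x 1 := hxC
      exact (mem_Omega hδ.1).2 ⟨by linarith [h1.1], by linarith [h1.2.1], by linarith [h1.2.2]⟩)
  have hmem : ∀ᵐ x ∂volume.restrict (Omega δ), x ∈ Omega δ := ae_restrict_mem hΩo.measurableSet
  have hdiag : ∀ᵐ x ∂volume.restrict (Omega δ), x ∉ {x : Plane | x 0 = x 1} :=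
    ae_restrict_of_ae (measure_eq_zero_iff_ae_notMem.1 volume_diagonal)
  -- The dominant value lies off `C` and is negative, so the sign is -1.
  refine hbound σp σm δ (-1) C φ _ hφ v (by simp) hC.measurableSet ?_ ?_
    (integrable_norm_grad_sq_of_smooth hψ hψs) ?_
  · filter_upwards [hv1, hmem, hdiag] with x hx hxm hxd hxC
    refine ⟨?_, hx hxC⟩
    rw [sigma_of_lt hδ.1 hxm (lt_of_le_of_ne hxC hxd)]
    ring
  · filter_upwards [hv2, hmem] with x hx hxm hxC
    refine ⟨?_, hx hxC⟩
    rw [sigma_of_gt hδ.1 hxm (not_le.1 hxC)]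
    ring
  · have := setIntegral_fold_le hφ hΩo.measurableSet hC.measurableSet
      (O := {x | x 0 < x 1}) (isOpen_lt (by fun_prop) (by fun_prop)).measurableSet
      (fun x hx => (lt_or_eq_of_le (show x 0 ≤ x 1 from hx.2)).imp (fun h => h) fun h => h) (G := planeMap swapMap)
      (a := fun _ => 0) (b := fun _ => Complex.I) (k := 1) (d := 1)
      (fun x _ => hasFDerivAt_planeMap (hasFDerivAt_swapMap _))
      (fun x _ y _ hxy => by
        ext i
        fin_cases i
        · have := congrArg (fun z : Plane => z 1) hxy
          simp only [planeMap_swapMap_one] at this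
          exact this
        · have := congrArg (fun z : Plane => z 0) hxy
          simp only [planeMap_swapMap_zero] at this
          exact this)
      one_pos (fun x _ => by simp) (fun x _ => by simp)
      (fun x hx hxC => by
        have hxC' : planeMap swapMap x 0 ≤ planeMap swapMap x 1 := hxC
        rw [planeMap_swapMap_zero, planeMap_swapMap_one] at hxC'
        exact not_lt.2 hxC' hx.2)
      (integrable_norm_grad_sq_of_smooth hψ hψs)
    simpa using this

/-- The fold is singular only at the origin, and there the composition vanishes on the ball of
radius `δ`. -/
theorem contDiff_comp_foldMap {δ : ℝ} (hδ : 0 < δ) {φ : Plane → ℂ}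
    (hφ : IsTestFunction (Omega δ) φ) : ContDiff ℝ ∞ (φ ∘ planeMap foldMap) := by
  rw [contDiff_iff_contDiffAt]
  intro x
  rcases eq_or_ne x 0 with rfl | hx
  · refine (contDiffAt_const (c := (0 : ℂ))).congr_of_eventuallyEq ?_
    filter_upwards [Metric.ball_mem_nhds (0 : Plane) hδ] with y hy
    refine hφ.eq_zero_of_notMem fun hm => ?_
    have h1 := ((mem_Omega hδ).1 hm).1
    rw [← norm_sq_eq_coord, norm_planeMap norm_foldMap] at h1
    rw [mem_ball_zero_iff] at hy
    nlinarith [norm_nonneg y]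
  · have hz : toC x ≠ 0 := by simpa using hx
    refine hφ.smooth.contDiffAt.comp x (toC.symm.contDiff.contDiffAt.comp x ?_)
    exact (contDiffAt_foldMap hz).comp x toC.contDiff.contDiffAt

/-- The uniform bound when the positive coefficient dominates. -/
theorem exists_bound_of_gt_neg_third {σp σm : ℝ} (hσm : σm < 0) (h : 3 * -σm < σp) :
    ∃ c : ℝ, 0 < c ∧ ∀ δ ∈ Ioo (0 : ℝ) 1, ∀ u : H10 (Omega δ), ‖u‖ ≤ c * ‖A σp σm δ u‖ := by
  obtain ⟨c, hc, hbound⟩ := exists_bound_of_fold (a := σp) (b := -σm) (N := 3) (by linarith)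
    (by linarith) three_pos h
  refine ⟨c, hc, fun δ hδ => bound_of_bound_test fun φ hφ => ?_⟩
  have hΩo := isOpen_Omega hδ.1
  have hGc : Continuous (planeMap foldMap) := continuous_planeMap continuous_foldMap
  have hψ := contDiff_comp_foldMap hδ.1 hφ
  have hψs := hasCompactSupport_comp hφ.compact hGc (norm_planeMap norm_foldMap)
  have hsq : ∀ x : Plane, planeMap foldMap x 0 ^ 2 + planeMap foldMap x 1 ^ 2 =
      x 0 ^ 2 + x 1 ^ 2 := fun x => by
    rw [← norm_sq_eq_coord, ← norm_sq_eq_coord, norm_planeMap norm_foldMap]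
  -- The half-plane condition is needed because θ ↦ π - 3θ also pulls the support of `φ` back below
  -- the axis, outside `Ω`.
  set C : Set Plane := {x | 0 ≤ x 1} ∩ {x | x 1 ≤ x 0} with hCdef
  have hC : IsClosed C := (isClosed_le (by fun_prop) (by fun_prop)).inter
    (isClosed_le (by fun_prop) (by fun_prop))
  have hfr : frontier C ⊆ {x | x 1 = 0} ∪ {x | x 0 = x 1} := by
    refine (frontier_inter_subset _ _).trans (union_subset_union ?_ ?_)
    · exact inter_subset_left.trans fun x hx =>
        (frontier_le_subset_eq continuous_const (continuous_coord 1) hx).symm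
    · exact inter_subset_right.trans fun x hx =>
        (frontier_le_subset_eq (continuous_coord 1) (continuous_coord 0) hx).symm
  obtain ⟨v, hv1, hv2⟩ := exists_H10_fold hΩo (volume_Omega_ne_top hδ.1) hφ hψ hψs hC
    (measure_mono_null hfr (measure_union_null volume_axis volume_diagonal))
    (fun x hx => by
      -- The frontier has two pieces: the fold maps the axis into itself, where `φ` vanishes, and
      -- fixes the diagonal.
      rcases hfr hx with h0 | h0
      · have h0' : x 1 = 0 := h0
        have h1 : x ∉ Omega δ := fun hm => ((mem_Omega hδ.1).1 hm).2.2.ne' h0'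
        have h2 : planeMap foldMap x ∉ Omega δ := fun hm => by
          refine ((mem_Omega hδ.1).1 hm).2.2.ne' ?_
          rw [planeMap_foldMap_one, h0']
          simp
        rw [Function.comp_apply, hφ.eq_zero_of_notMem h1, hφ.eq_zero_of_notMem h2]
      · rw [Function.comp_apply, planeMap_foldMap_of_diagonal h0])
    (by
      rintro x ⟨⟨hx1, -⟩, hx⟩
      have h1 := (mem_Omega hδ.1).1 (hφ.support (tsupport_comp_subset hGc hx))
      rw [hsq] at h1
      refine (mem_Omega hδ.1).2 ⟨h1.1, h1.2.1, lt_of_le_of_ne hx1 fun h0 => h1.2.2.ne' ?_⟩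
      rw [planeMap_foldMap_one, ← h0]
      simp)
  have hmem : ∀ᵐ x ∂volume.restrict (Omega δ), x ∈ Omega δ := ae_restrict_mem hΩo.measurableSet
  have hdiag : ∀ᵐ x ∂volume.restrict (Omega δ), x ∉ {x : Plane | x 0 = x 1} :=
    ae_restrict_of_ae (measure_eq_zero_iff_ae_notMem.1 volume_diagonal)
  refine hbound σp σm δ 1 C φ _ hφ v (by simp) hC.measurableSet ?_ ?_
    (integrable_norm_grad_sq_of_smooth hψ hψs) ?_
  · filter_upwards [hv1, hmem, hdiag] with x hx hxm hxd hxC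
    refine ⟨?_, hx hxC⟩
    rw [sigma_of_gt hδ.1 hxm (lt_of_le_of_ne hxC.2 (Ne.symm hxd))]
    ring
  · filter_upwards [hv2, hmem] with x hx hxm hxC
    refine ⟨?_, hx hxC⟩
    rw [sigma_of_lt hδ.1 hxm (not_le.1 fun hle => hxC ⟨((mem_Omega hδ.1).1 hxm).2.2.le, hle⟩)]
    ring
  · have hne : ∀ x ∈ Omega δ, toC x ≠ 0 := fun x hx h0 => by
      have := ((mem_Omega hδ.1).1 hx).2.2
      rw [← toC_im, h0] at this
      exact this.false
    have hq : ∀ x ∈ Omega δ, ‖(starRingEnd ℂ) (toC x) / toC x‖ = 1 := fun x hx => by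
      rw [norm_div, RCLike.norm_conj, div_self (norm_ne_zero_iff.2 (hne x hx))]
    have := setIntegral_fold_le hφ hΩo.measurableSet hC.measurableSet
      (O := {x | x 1 < x 0}) (isOpen_lt (by fun_prop) (by fun_prop)).measurableSet
      (fun x hx => (lt_or_eq_of_le (show x 1 ≤ x 0 from hx.2.2)).imp (fun h => h) Eq.symm) (G := planeMap foldMap)
      (a := fun x => ((starRingEnd ℂ) (toC x) / toC x) ^ 2)
      (b := fun x => -2 * ((starRingEnd ℂ) (toC x) / toC x)) (k := 3) (d := 3)
      (fun x hx => hasFDerivAt_planeMap (hasFDerivAt_foldMap (hne x hx.1)))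
      (fun x hx y hy hxy => by
        have hin : ∀ z ∈ Omega δ ∩ {x | x 1 < x 0}, 0 < (toC z).im ∧ (toC z).im < (toC z).re := by
          intro z hz
          rw [toC_im, toC_re]
          exact ⟨((mem_Omega hδ.1).1 hz.1).2.2, hz.2⟩
        exact toC.injective (foldMap_injOn (hin x hx) (hin y hy) (toC.symm.injective hxy)))
      three_pos
      (fun x hx => by
        rw [norm_mul, norm_pow, hq x hx.1]
        norm_num)
      (fun x hx => by
        rw [norm_mul, norm_pow, hq x hx.1]
        norm_num)
      (fun x hx hxC => by
        have h1 : planeMap foldMap x 1 ≤ planeMap foldMap x 0 := hxC.2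
        have hx1 : 0 < x 1 := ((mem_Omega hδ.1).1 hx.1).2.2
        have hx2 : x 1 < x 0 := hx.2
        have hx0 : 0 < x 0 := hx1.trans hx2
        rw [planeMap_foldMap_zero, planeMap_foldMap_one,
          div_le_div_iff_of_pos_right (by positivity)] at h1
        -- This product is the difference of the numerators of the two image coordinates, so its
        -- positivity places the image above the diagonal.
        have : (x 0 - x 1) * (x 0 ^ 2 + 4 * (x 0 * x 1) + x 1 ^ 2) ≤ 0 := by
          linarith
        have : 0 < (x 0 - x 1) * (x 0 ^ 2 + 4 * (x 0 * x 1) + x 1 ^ 2) :=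
          mul_pos (by linarith) (by positivity)
        linarith)
      (integrable_norm_grad_sq_of_smooth hψ hψs)
    have e : (3 : ℝ) ^ 2 / 3 = 3 := by norm_num
    rwa [e] at this

end HalfAnnulus

/-! ### Conclusion: the two ranges of the contrast -/

theorem proposition7p1 (σp σm : ℝ) (hσp : 0 < σp) (hσm : σm < 0)
    (hκ : σm / σp ∈ Set.Iio (-1 : ℝ) ∪ Set.Ioo (-1 / 3 : ℝ) 0) :
    (∀ δ ∈ Set.Ioo (0 : ℝ) 1,
      ∃ e : HalfAnnulus.H10 (HalfAnnulus.Omega δ) ≃L[ℂ]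
          HalfAnnulus.Hneg1 (HalfAnnulus.Omega δ),
        ∀ u, e u = HalfAnnulus.A σp σm δ u) ∧
    ∃ c : ℝ, 0 < c ∧ ∀ δ ∈ Set.Ioo (0 : ℝ) 1,
      ∀ u : HalfAnnulus.H10 (HalfAnnulus.Omega δ),
        ‖u‖ ≤ c * ‖HalfAnnulus.A σp σm δ u‖ := by
  have hbound : ∃ c : ℝ, 0 < c ∧ ∀ δ ∈ Set.Ioo (0 : ℝ) 1,
      ∀ u : HalfAnnulus.H10 (HalfAnnulus.Omega δ), ‖u‖ ≤ c * ‖HalfAnnulus.A σp σm δ u‖ := by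
    rcases hκ with h | ⟨h, -⟩
    · refine HalfAnnulus.exists_bound_of_lt_neg_one hσp ?_
      rw [Set.mem_Iio, div_lt_iff₀ hσp] at h
      linarith
    · refine HalfAnnulus.exists_bound_of_gt_neg_third hσm ?_
      rw [lt_div_iff₀ hσp] at h
      linarith
  refine ⟨fun δ hδ => ?_, hbound⟩
  obtain ⟨c, hc, hb⟩ := hbound
  have hΩ : ∀ x ∈ HalfAnnulus.Omega δ, |x 0| ≤ 1 := fun x hx =>
    HalfAnnulus.abs_coord_le_of_mem_Omega hδ.1 hx
  have := HalfAnnulus.completeSpace_range_gradient hΩ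
  exact HalfAnnulus.exists_continuousLinearEquiv_of_hermitian (HalfAnnulus.H10.equivRange hΩ) _
    (HalfAnnulus.form_conj σp σm δ) hc (hb δ hδ)
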